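/- Let $\zeta$ be a transcendental real number. For an integer polynomial $P$ let $H(P)$ be the maximum modulus of its coefficients. For $n\ge 1$ let $w_n(\zeta)\in[n,\infty]$ be the supremum of the real $w$ such that $0<|P(\zeta)|\le H(P)^{-w}$ has infinitely many solutions $P\in\mathbb{Z}[T]$ of degree at most $n$. For a real algebraic number $\alpha$ let $H(\alpha)=H(P)$, where $P$ is the (up to sign unique) minimal polynomial of $\alpha$ with coprime integer coefficients, and let $\widehat{w}^*_n(\zeta)$ be the supremum of the real $w^*$ such that, for all sufficiently large $X$, there is a real algebraic number $\alpha$ of degree at most $n$ with $$H(\alpha)\le X,\qquad |\zeta-\alpha|\le H(\alpha)^{-1}X^{-w^*}.$$ The number $\zeta$ is called a $U_m$-number ($m\ge 1$) if $w_m(\zeta)=\infty$ and $m$ is the smallest positive index with this property; a $U$-number if it is a $U_m$-number for some $m\ge 1$; a $T$-number if $w_n(\zeta)<\infty$ for all $n\ge 1$ and $\limsup_{n\to\infty} w_n(\zeta)/n=\infty$; and an $S$-number if there is a constant $C$ with $w_n(\zeta)\le Cn$ for all $n\ge 1$. **Theorem 2.4 (Equivalence principle II).** 1. $\zeta$ is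 a $U$-number if and only if $\lim_{n\to\infty}\widehat{w}^*_n(\zeta)<\infty$ (that is, the sequence converges to a real number). More precisely, if $\zeta$ is a $U_m$-number, then $\widehat{w}^*_n(\zeta)\in[m-1,m]$ for all sufficiently large $n$. 2. $\zeta$ is a $T$-number if and only if $\lim_{n\to\infty}\widehat{w}^*_n(\zeta)=\infty$ and $\liminf_{n\to\infty}\widehat{w}^*_n(\zeta)/n=0$. 3. $\zeta$ is an $S$-number if and only if there is a constant $\delta>0$ such that $\widehat{w}^*_n(\zeta)\ge\delta n$ for all $n\ge 1$. -/

import Mathlib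

open Filter Topology

namespace MahlerClassification

/-- The classical exponent `w_n(ζ)`: the supremum, in `[-∞, ∞]`, of the real `w` such that
`0 < |P(ζ)| ≤ H(P)^(-w)` for infinitely many integer polynomials `P` of degree at most `n`.
The naive height `H(P)` is the maximum modulus of the coefficients, `Polynomial.supNorm P`. -/
noncomputable def w (n : ℕ) (ζ : ℝ) : EReal :=
  sSup ((fun t : ℝ => (t : EReal)) ''
    {t : ℝ | {P : Polynomial ℤ | P.natDegree ≤ n ∧ 0 < |Polynomial.aeval ζ P| ∧
      |Polynomial.aeval ζ P| ≤ P.supNorm ^ (-t)}.Infinite})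

/-- `P` is a minimal polynomial with coprime integer coefficients of the (hence algebraic) real
number `α`: it is primitive, irreducible over `ℚ`, and vanishes at `α`. Such a `P` exists for every
real algebraic `α` and is unique up to sign; the degree and height of `α` are those of `P`. -/
def IsMinimalPolynomial (P : Polynomial ℤ) (α : ℝ) : Prop :=
  P.IsPrimitive ∧ Irreducible (P.map (Int.castRingHom ℚ)) ∧ Polynomial.aeval α P = 0

/-- The uniform exponent `ŵ*_n(ζ)`: the supremum, in `[-∞, ∞]`, of the real `t` such that for all
large `X` there is a real algebraic number `α` of degree at most `n` with `H(α) ≤ X` and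
`|ζ - α| ≤ H(α)^(-1) X^(-t)`. -/
noncomputable def wHatStar (n : ℕ) (ζ : ℝ) : EReal :=
  sSup ((fun t : ℝ => (t : EReal)) ''
    {t : ℝ | ∀ᶠ X : ℝ in atTop, ∃ (α : ℝ) (P : Polynomial ℤ), IsMinimalPolynomial P α ∧
      P.natDegree ≤ n ∧ P.supNorm ≤ X ∧ |ζ - α| ≤ P.supNorm⁻¹ * X ^ (-t)})

/-- `ζ` is a `U_m`-number: it is transcendental and `m` is the smallest positive index with
`w_m(ζ) = ∞`. -/
def IsUmNumber (m : ℕ) (ζ : ℝ) : Prop :=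
  Transcendental ℚ ζ ∧ 1 ≤ m ∧ w m ζ = ⊤ ∧ ∀ k : ℕ, 1 ≤ k → k < m → w k ζ < ⊤

/-- `ζ` is a `U`-number: a `U_m`-number for some `m ≥ 1`. -/
def IsUNumber (ζ : ℝ) : Prop :=
  ∃ m : ℕ, IsUmNumber m ζ

/-- `ζ` is a `T`-number: transcendental, `w_n(ζ) < ∞` for all `n ≥ 1`, and
`limsup w_n(ζ)/n = ∞`. -/
def IsTNumber (ζ : ℝ) : Prop :=
  Transcendental ℚ ζ ∧ (∀ n : ℕ, 1 ≤ n → w n ζ < ⊤) ∧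
    limsup (fun n : ℕ => w n ζ / ((n : ℝ) : EReal)) atTop = ⊤

/-- `ζ` is an `S`-number: transcendental, and `w_n(ζ)/n` is bounded over `n ≥ 1`. -/
def IsSNumber (ζ : ℝ) : Prop :=
  Transcendental ℚ ζ ∧ ∃ C : ℝ, ∀ n : ℕ, 1 ≤ n → w n ζ ≤ ((C * n : ℝ) : EReal)

end MahlerClassification

/-!
Every transcendental number is of exactly one of the types `S`, `T`, `U`, so it suffices to compare
the finiteness and the growth of `w_k(ζ)` with those of `ŵ*_n(ζ)`. Two inequalities do this.

*Lower bound* (`natCast_le_wHatStar`): if `w_k(ζ) < W`, then `ŵ*_N(ζ) ≥ k` as soon as `N ≥ W +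
2k`. For each large `X`, Dirichlet's theorem gives `Q` of degree at most `k` and `A` of degree at
most `M ≥ W + k`, both of height at most `X`, with `|Q(ζ)| ≪ X^(-k)` and `|A(ζ)| ≪ X^(-M)`. Remove
from `A` all irreducible factors of degree at most `k`. As the Mahler measure is multiplicative,
the removed part has value `≫ X^(-W)` at `ζ`, so what is left still has value `≪ X^(-k)`, and it
is coprime to `Q` (`exists_coprime_small_values`). Two coprime polynomials generate, over the
reals and in bounded degree, a large multiple of `X (T - ζ)`; rounding the cofactors to integer
coefficients gives an integer polynomial of height `≪ X` that changes sign within `O(X^(-k-1))` of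
`ζ` (`exists_isMinimalPolynomial_near`). A real root there is the required algebraic number.

*Upper bound* (`wHatStar_le_of_lt_w`): if `w_k(ζ) > t ≥ n`, then
`ŵ*_n(ζ) ≤ k + k n / (t - n + 1)`. Take `Q` of degree at most `k` with `|Q(ζ)| ≤ H(Q)^(-t)`, and
choose `X` with `X^k` of order `1 / (|Q(ζ)| H(Q)^(n-1))`. An algebraic number of degree at most `n`
and height at most `X` either has a minimal polynomial coprime to `Q`, and then the resultant keeps
it away from `ζ` (`one_le_of_isCoprime`), or it is a root of `Q`, and then `|Q(ζ)|` itself does.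

For a `U_m`-number, the lower bound with `k = m - 1` and the upper bound with `k = m` and `t → ∞`
give `m - 1 ≤ ŵ*_n(ζ) ≤ m` for large `n`. If all `w_k(ζ)` are finite, the lower bound gives
`ŵ*_n(ζ) → ∞`. If `w_k(ζ) ≤ C k`, it gives `ŵ*_n(ζ) ≫ n`. Conversely, `w_k(ζ) > 2 b k` implies
`ŵ*_{b k}(ζ) ≤ 2 k` (`wHatStar_mul_le`), so that `w_k(ζ) / k` is bounded if `ŵ*_n(ζ) / n` is bounded
away from `0`.
-/

namespace MahlerClassification

open Polynomial

/-! ### Heights and Mahler measures of integer polynomials -/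

/-- The Mahler measure of an integer polynomial; it is comparable to the naive height in bounded
degree and, unlike the height, multiplicative. -/
noncomputable def mahler (P : ℤ[X]) : ℝ := (P.map (Int.castRingHom ℂ)).mahlerMeasure

lemma mahler_mul (P Q : ℤ[X]) : mahler (P * Q) = mahler P * mahler Q := by
  simp [mahler, Polynomial.mahlerMeasure_mul]

lemma one_le_mahler {P : ℤ[X]} (hP : P ≠ 0) : 1 ≤ mahler P :=
  one_le_mahlerMeasure_of_ne_zero hP

lemma supNorm_map_intCast (P : ℤ[X]) : (P.map (Int.castRingHom ℂ)).supNorm = P.supNorm := by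
  simp [supNorm_eq_iSup, Int.norm_eq_abs]

lemma abs_coeff_le_supNorm (P : ℤ[X]) (i : ℕ) : |(P.coeff i : ℝ)| ≤ P.supNorm := by
  simpa [Int.norm_eq_abs] using P.le_supNorm i

lemma supNorm_le_of_forall {P : ℤ[X]} {B : ℝ} (h : ∀ i, |(P.coeff i : ℝ)| ≤ B) :
    P.supNorm ≤ B := by
  obtain ⟨i, hi⟩ := P.exists_eq_supNorm
  rw [hi]
  simpa [Int.norm_eq_abs] using h i

lemma one_le_supNorm {P : ℤ[X]} (hP : P ≠ 0) : 1 ≤ P.supNorm := by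
  refine le_trans ?_ (abs_coeff_le_supNorm P P.natDegree)
  exact_mod_cast Int.one_le_abs (leadingCoeff_ne_zero.mpr hP)

lemma mahler_le_mul_supNorm {P : ℤ[X]} {n : ℕ} (hn : P.natDegree ≤ n) :
    mahler P ≤ (n + 1) * P.supNorm := by
  have h := mahlerMeasure_le_sqrt_natDegree_add_one_mul_supNorm (P.map (Int.castRingHom ℂ))
  rw [supNorm_map_intCast] at h
  refine h.trans (mul_le_mul_of_nonneg_right ?_ P.supNorm_nonneg)
  have h1 : ((P.map (Int.castRingHom ℂ)).natDegree : ℝ) ≤ n := by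
    exact_mod_cast natDegree_map_le.trans hn
  rw [Real.sqrt_le_left (by positivity)]
  nlinarith [(Nat.cast_nonneg n : (0 : ℝ) ≤ n)]

lemma supNorm_le_mul_mahler {P : ℤ[X]} {n : ℕ} (hn : P.natDegree ≤ n) :
    P.supNorm ≤ 2 ^ n * mahler P := by
  have h := supNorm_le_choose_natDegree_div_two_mul_mahlerMeasure (P.map (Int.castRingHom ℂ))
  rw [supNorm_map_intCast] at h
  refine h.trans (mul_le_mul_of_nonneg_right ?_ (mahlerMeasure_nonneg _))
  have h1 : (P.map (Int.castRingHom ℂ)).natDegree ≤ n := natDegree_map_le.trans hn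
  exact_mod_cast (Nat.choose_le_two_pow _ _).trans (Nat.pow_le_pow_right (by norm_num) h1)

lemma mahler_le_of_dvd {P F : ℤ[X]} (h : P ∣ F) (hF : F ≠ 0) : mahler P ≤ mahler F := by
  obtain ⟨R, rfl⟩ := h
  rw [mahler_mul]
  exact le_mul_of_one_le_right (mahlerMeasure_nonneg _) (one_le_mahler (right_ne_zero_of_mul hF))

lemma supNorm_le_of_dvd {P F : ℤ[X]} {n : ℕ} (h : P ∣ F) (hF : F ≠ 0) (hn : F.natDegree ≤ n) :
    P.supNorm ≤ 2 ^ n * (n + 1) * F.supNorm := by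
  rw [mul_assoc]
  refine (supNorm_le_mul_mahler ((natDegree_le_of_dvd h hF).trans hn)).trans ?_
  gcongr
  exact (mahler_le_of_dvd h hF).trans (mahler_le_mul_supNorm hn)

lemma finite_setOf_supNorm_le (n : ℕ) (B : ℝ) :
    {P : ℤ[X] | P.natDegree ≤ n ∧ P.supNorm ≤ B}.Finite := by
  refine (finite_mahlerMeasure_le n (Real.toNNReal ((n + 1) * B))).subset ?_
  rintro P ⟨h1, h2⟩
  refine ⟨h1, le_trans ((mahler_le_mul_supNorm h1).trans ?_) (Real.le_coe_toNNReal _)⟩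
  gcongr

/-! ### Values of polynomials with bounded coefficients -/

lemma eval_eq_sum_range_of_le {p : ℝ[X]} {n : ℕ} (hn : p.natDegree ≤ n) (x : ℝ) :
    p.eval x = ∑ i ∈ Finset.range (n + 1), p.coeff i * x ^ i :=
  eval_eq_sum_range' (Nat.lt_succ_of_le hn) x

lemma abs_eval_le {p : ℝ[X]} {n : ℕ} {B Z x : ℝ} (hn : p.natDegree ≤ n)
    (hB : ∀ i, |p.coeff i| ≤ B) (hZ : 1 ≤ Z) (hx : |x| ≤ Z) :
    |p.eval x| ≤ (n + 1) * (B * Z ^ n) := by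
  have hB0 : 0 ≤ B := (abs_nonneg _).trans (hB 0)
  rw [eval_eq_sum_range_of_le hn]
  refine (Finset.abs_sum_le_sum_abs _ _).trans ?_
  refine (Finset.sum_le_card_nsmul _ _ (B * Z ^ n) fun i hi => ?_).trans (by simp)
  rw [abs_mul, abs_pow]
  have h1 : |x| ^ i ≤ Z ^ n := (pow_le_pow_left₀ (abs_nonneg _) hx i).trans
    (pow_le_pow_right₀ hZ (Nat.lt_succ_iff.mp (Finset.mem_range.mp hi)))
  exact mul_le_mul (hB i) h1 (by positivity) hB0

lemma abs_eval_sub_eval_le {p : ℝ[X]} {n : ℕ} {B Z x y : ℝ} (hn : p.natDegree ≤ n)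
    (hB : ∀ i, |p.coeff i| ≤ B) (hZ : 1 ≤ Z) (hx : |x| ≤ Z) (hy : |y| ≤ Z) :
    |p.eval x - p.eval y| ≤ (n + 1) * (B * (n * Z ^ n)) * |x - y| := by
  have hB0 : 0 ≤ B := (abs_nonneg _).trans (hB 0)
  rw [eval_eq_sum_range_of_le hn, eval_eq_sum_range_of_le hn, ← Finset.sum_sub_distrib]
  refine (Finset.abs_sum_le_sum_abs _ _).trans ?_
  refine (Finset.sum_le_card_nsmul _ _ (B * (n * Z ^ n) * |x - y|) fun i hi => ?_).trans
    (by simp [mul_assoc])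
  rw [← mul_sub, abs_mul, mul_assoc]
  refine mul_le_mul (hB i) ?_ (abs_nonneg _) hB0
  refine (abs_pow_sub_pow_le x y i).trans ?_
  have hin : i ≤ n := Nat.lt_succ_iff.mp (Finset.mem_range.mp hi)
  have h1 : max |x| |y| ^ (i - 1) ≤ Z ^ n :=
    (pow_le_pow_left₀ (le_max_of_le_left (abs_nonneg _)) (max_le hx hy) _).trans
      (pow_le_pow_right₀ hZ (by omega))
  calc |x - y| * i * max |x| |y| ^ (i - 1) ≤ |x - y| * n * Z ^ n := by gcongr
    _ = n * Z ^ n * |x - y| := by ring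

lemma aeval_eq_eval_map (P : ℤ[X]) (x : ℝ) :
    aeval x P = (P.map (Int.castRingHom ℝ)).eval x := by
  rw [eval_map]; rfl

lemma abs_aeval_le {P : ℤ[X]} {n : ℕ} (hn : P.natDegree ≤ n) (x : ℝ) :
    |aeval x P| ≤ (n + 1) * (P.supNorm * max 1 |x| ^ n) := by
  rw [aeval_eq_eval_map]
  exact abs_eval_le (natDegree_map_le.trans hn) (fun i => by simpa using abs_coeff_le_supNorm P i)
    (le_max_left _ _) (le_max_right _ _)

lemma aeval_ne_zero {ζ : ℝ} (hζ : Transcendental ℚ ζ) {P : ℤ[X]} (hP : P ≠ 0) :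
    aeval ζ P ≠ 0 := by
  have h : Transcendental ℤ ζ := fun h => hζ ((IsFractionRing.isAlgebraic_iff ℤ ℚ ℝ).mp h)
  exact fun h0 => hP (transcendental_iff.mp h P h0)

/-! ### Irreducible integer factors -/

/-- Over an extension ring, a prime divisor of an integer polynomial divides one of its irreducible
factors in `ℤ[T]`. It is used with `T - α` over `ℝ`, and with irreducible polynomials over `ℚ`. -/
lemma exists_irreducible_dvd_of_prime_dvd_map {K : Type*} [CommRing K] (φ : ℤ →+* K)
    {g : K[X]} (hg : Prime g) {A : ℤ[X]} (hA : A ≠ 0) (h : g ∣ A.map φ) :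
    ∃ p : ℤ[X], Irreducible p ∧ p ∣ A ∧ g ∣ p.map φ := by
  obtain ⟨s, hs, u, hu⟩ := UniqueFactorizationMonoid.exists_prime_factors A hA
  rw [← hu, Polynomial.map_mul, Polynomial.map_multiset_prod] at h
  have hunit : IsUnit ((u : ℤ[X]).map φ) := (u.isUnit).map (mapRingHom φ)
  obtain ⟨q, hq, hgq⟩ := hg.exists_mem_multiset_dvd (hunit.dvd_mul_right.mp h)
  obtain ⟨p, hp, rfl⟩ := Multiset.mem_map.mp hq
  exact ⟨p, (hs p hp).irreducible, hu ▸ (Multiset.dvd_prod hp).mul_right _, hgq⟩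

/-! ### A lower bound for the values of two coprime integer polynomials -/

lemma abs_det_le_of_row {n : ℕ} (A : Matrix (Fin n) (Fin n) ℝ) (i₀ : Fin n) (r : Fin n → ℝ)
    {ε : ℝ} (h0 : ∀ j, |A i₀ j| ≤ ε * r j) (h : ∀ i j, i ≠ i₀ → |A i j| ≤ r j) :
    |A.det| ≤ n.factorial * (ε * ∏ j, r j) := by
  rw [Matrix.det_apply]
  refine (Finset.abs_sum_le_sum_abs _ _).trans ?_
  refine (Finset.sum_le_card_nsmul _ _ (ε * ∏ j, r j) fun σ _ => ?_).trans
    (by simp [Finset.card_univ, Fintype.card_perm])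
  have h1 : |Equiv.Perm.sign σ • ∏ i, A (σ i) i| = ∏ i, |A (σ i) i| := by
    rcases Int.units_eq_one_or (Equiv.Perm.sign σ) with h | h <;> simp [h, Finset.abs_prod]
  rw [h1, ← Finset.mul_prod_erase _ _ (Finset.mem_univ (σ⁻¹ i₀)),
    ← Finset.mul_prod_erase _ r (Finset.mem_univ (σ⁻¹ i₀)), ← mul_assoc]
  have h2 : |A (σ (σ⁻¹ i₀)) (σ⁻¹ i₀)| ≤ ε * r (σ⁻¹ i₀) := by simpa using h0 (σ⁻¹ i₀)
  refine mul_le_mul h2 (Finset.prod_le_prod (fun _ _ => abs_nonneg _) fun j hj => ?_)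
    (Finset.prod_nonneg fun _ _ => abs_nonneg _) ((abs_nonneg _).trans h2)
  refine h _ _ fun hj' => (Finset.mem_erase.mp hj).1 ?_
  simp [← hj']

lemma ite_coeff_eq_coeff_X_pow_mul {p : ℝ[X]} {n : ℕ} (hp : p.natDegree ≤ n) (i j : ℕ) :
    (if i ∈ Set.Icc j (j + n) then p.coeff (i - j) else 0) = (X ^ j * p).coeff i := by
  rw [coeff_X_pow_mul']
  by_cases h1 : j ≤ i
  · by_cases h2 : i ≤ j + n
    · simp [h1, h2]
    · simp only [Set.mem_Icc, h1, h2, and_false, if_false, if_true]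
      exact (coeff_eq_zero_of_natDegree_lt (by omega)).symm
  · simp [h1]

lemma sum_pow_mul_ite_coeff {p : ℝ[X]} {m n : ℕ} (hp : p.natDegree ≤ n) (x : ℝ) {j : ℕ}
    (hj : j < m) {N : ℕ} (hN : N = m + n) :
    ∑ i : Fin N, x ^ (i : ℕ) *
      (if (i : ℕ) ∈ Set.Icc j (j + n) then p.coeff (i - j) else 0) = x ^ j * p.eval x := by
  have h1 : (X ^ j * p).natDegree < N := by
    refine (natDegree_mul_le.trans (Nat.add_le_add (natDegree_X_pow_le j) hp)).trans_lt ?_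
    omega
  have h2 := eval_eq_sum_range' h1 x
  rw [eval_mul, eval_pow, eval_X] at h2
  rw [h2]
  refine Eq.trans ?_ (Fin.sum_univ_eq_sum_range (fun i : ℕ => (X ^ j * p).coeff i * x ^ i) N)
  exact Finset.sum_congr rfl fun i _ => by rw [ite_coeff_eq_coeff_X_pow_mul hp, mul_comm]

/-- Up to a constant, the resultant of two polynomials is bounded by the product of the heights with
the values at `x`, relative to the heights: this is seen by replacing one row of the Sylvester
matrix by the combination of all rows with weights `1, x, x², …`. -/
lemma abs_resultant_le {p q : ℝ[X]} {m n : ℕ} (hp : p.natDegree ≤ m) (hq : q.natDegree ≤ n)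
    {a b x : ℝ} (ha : 0 < a) (hb : 0 < b) (hpa : ∀ i, |p.coeff i| ≤ a)
    (hqb : ∀ i, |q.coeff i| ≤ b) (hmn : 0 < m + n) :
    |resultant p q m n| ≤ (m + n).factorial *
      (max 1 |x| ^ (m + n) * (|p.eval x| / a + |q.eval x| / b) * (b ^ m * a ^ n)) := by
  set Z := max 1 |x| with hZ
  have hZ1 : 1 ≤ Z := le_max_left _ _
  have hZx : |x| ≤ Z := le_max_right _ _
  let S := sylvester p q m n
  let i₀ : Fin (m + n) := ⟨0, hmn⟩
  let r : Fin (m + n) → ℝ := fun j => j.addCases (fun _ => b) (fun _ => a)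
  let A := S.updateRow i₀ (∑ i : Fin (m + n), x ^ (i : ℕ) • S i)
  have hdet : A.det = resultant p q m n := by
    simp only [A]
    rw [Matrix.det_updateRow_sum]
    simp [i₀, S, resultant]
  have hprod : ∏ j, r j = b ^ m * a ^ n := by
    rw [Fin.prod_univ_add]
    simp [r]
  have hε : 0 ≤ |p.eval x| / a + |q.eval x| / b := by positivity
  have hpow : ∀ j : ℕ, j ≤ m + n → |x ^ j| ≤ Z ^ (m + n) := fun j hj => by
    rw [abs_pow]
    exact (pow_le_pow_left₀ (abs_nonneg _) hZx _).trans (pow_le_pow_right₀ hZ1 hj)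
  rw [← hdet, ← hprod]
  refine abs_det_le_of_row A i₀ r (fun j => ?_) fun i j hi => ?_
  · simp only [A, Matrix.updateRow_self, Finset.sum_apply, Pi.smul_apply, smul_eq_mul]
    induction j using Fin.addCases with
    | left j =>
      simp only [S, sylvester, Matrix.of_apply, Fin.addCases_left, r]
      rw [sum_pow_mul_ite_coeff hq x j.2 rfl, abs_mul]
      have h1 : |q.eval x| ≤ (|p.eval x| / a + |q.eval x| / b) * b := by
        rw [add_mul, div_mul_cancel₀ _ hb.ne']
        have : 0 ≤ |p.eval x| / a * b := by positivity
        linarith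
      rw [mul_assoc]
      exact mul_le_mul (hpow _ (by omega)) h1 (abs_nonneg _) (by positivity)
    | right j =>
      simp only [S, sylvester, Matrix.of_apply, Fin.addCases_right, r]
      rw [sum_pow_mul_ite_coeff hp x j.2 (Nat.add_comm m n), abs_mul]
      have h1 : |p.eval x| ≤ (|p.eval x| / a + |q.eval x| / b) * a := by
        rw [add_mul, div_mul_cancel₀ _ ha.ne']
        have : 0 ≤ |q.eval x| / b * a := by positivity
        linarith
      rw [mul_assoc]
      exact mul_le_mul (hpow _ (by omega)) h1 (abs_nonneg _) (by positivity)
  · simp only [A, Matrix.updateRow_ne hi]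
    induction j using Fin.addCases with
    | left j =>
      simp only [S, sylvester, Matrix.of_apply, Fin.addCases_left, r]
      split_ifs
      · exact hqb _
      · simpa using hb.le
    | right j =>
      simp only [S, sylvester, Matrix.of_apply, Fin.addCases_right, r]
      split_ifs
      · exact hpa _
      · simpa using ha.le

/-- A Liouville inequality: coprime integer polynomials cannot both be very small at `x`. -/
lemma one_le_of_isCoprime {P Q : ℤ[X]} {k n : ℕ} (hP : P ≠ 0) (hQ : Q ≠ 0)
    (hPn : P.natDegree ≤ n) (hQk : Q.natDegree ≤ k) (hP0 : 0 < P.natDegree)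
    (h : IsCoprime (P.map (Int.castRingHom ℚ)) (Q.map (Int.castRingHom ℚ))) (x : ℝ) :
    1 ≤ (n + k).factorial * (max 1 |x| ^ (n + k) *
      (|aeval x P| / P.supNorm + |aeval x Q| / Q.supNorm) * (Q.supNorm ^ n * P.supNorm ^ k)) := by
  have hres : resultant P Q ≠ 0 := by
    have h1 := resultant_ne_zero _ _ h
    rw [natDegree_map_eq_of_injective (Int.castRingHom ℚ).injective_int,
      natDegree_map_eq_of_injective (Int.castRingHom ℚ).injective_int, resultant_map_map] at h1
    exact fun h0 => h1 (by simp [h0])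
  have hP1 := one_le_supNorm hP
  have hQ1 := one_le_supNorm hQ
  have hbound := abs_resultant_le (p := P.map (Int.castRingHom ℝ)) (q := Q.map (Int.castRingHom ℝ))
    natDegree_map_le natDegree_map_le (x := x) (a := P.supNorm) (b := Q.supNorm) (by linarith)
    (by linarith) (fun i => by simpa using abs_coeff_le_supNorm P i)
    (fun i => by simpa using abs_coeff_le_supNorm Q i) (by omega)
  rw [resultant_map_map, ← aeval_eq_eval_map, ← aeval_eq_eval_map] at hbound
  have h1 : (1 : ℝ) ≤ |(Int.castRingHom ℝ) (resultant P Q)| := by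
    rw [eq_intCast]
    exact_mod_cast Int.one_le_abs hres
  refine (h1.trans hbound).trans ?_
  have hZ : 1 ≤ max 1 |x| := le_max_left _ _
  gcongr

/-! ### Upper bound for the uniform exponent -/

lemma IsMinimalPolynomial.ne_zero {P : ℤ[X]} {α : ℝ} (h : IsMinimalPolynomial P α) : P ≠ 0 :=
  h.1.ne_zero

lemma IsMinimalPolynomial.natDegree_pos {P : ℤ[X]} {α : ℝ} (h : IsMinimalPolynomial P α) :
    0 < P.natDegree := by
  by_contra h0
  have h1 := eq_C_of_natDegree_eq_zero (Nat.eq_zero_of_not_pos h0)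
  have h2 := h.2.2
  rw [h1] at h2
  simp only [eq_intCast, map_intCast, Int.cast_eq_zero] at h2
  rw [h2] at h1
  exact h.ne_zero (by simpa using h1)

/-- If the minimal polynomial `P` of `α` is not a factor of `Q`, the Liouville inequality bounds
`|ζ - α|` from below as long as `X` is not too large in terms of `Q`; if it is a factor, `|P(ζ)|`
cannot be much smaller than `|Q(ζ)|`. -/
lemma exists_rpow_le_mul_pow {ζ : ℝ} (hζ : Transcendental ℚ ζ) (k n : ℕ) :
    ∃ K C : ℝ, 1 ≤ K ∧ 1 ≤ C ∧ ∀ (Q : ℤ[X]) (X s : ℝ), Q ≠ 0 → Q.natDegree ≤ k → 1 ≤ X → 0 ≤ s →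
      X ^ k * (2 * K * |aeval ζ Q| * Q.supNorm ^ n) = Q.supNorm →
      (∃ (α : ℝ) (P : ℤ[X]), IsMinimalPolynomial P α ∧
        P.natDegree ≤ n ∧ P.supNorm ≤ X ∧ |ζ - α| ≤ P.supNorm⁻¹ * X ^ (-s)) →
      X ^ s ≤ C * (X ^ k * Q.supNorm ^ n) := by
  set Z := max 1 |ζ| with hZ
  have hZ1 : 1 ≤ Z := le_max_left _ _
  set K : ℝ := (n + k).factorial * Z ^ (n + k) with hK
  have hK1 : 1 ≤ K := by
    have h1 : (1 : ℝ) ≤ (n + k).factorial := by exact_mod_cast Nat.factorial_pos _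
    exact one_le_mul_of_one_le_of_one_le h1 (one_le_pow₀ hZ1)
  set L : ℝ := (n + 1) * (n * (Z + 1) ^ n) with hL
  have hL0 : 0 ≤ L := by positivity
  set C₂ : ℝ := (k + 1) * (2 ^ k * (k + 1) * Z ^ k) with hC₂
  have hC₂0 : 0 ≤ C₂ := by positivity
  refine ⟨K, 1 + 2 * K * L + 2 * K * L * C₂, hK1, ?_, ?_⟩
  · have : 0 ≤ 2 * K * L := by positivity
    have : 0 ≤ 2 * K * L * C₂ := by positivity
    linarith
  rintro Q X s hQ hQk hX hs hXQ ⟨α, P, hP, hPn, hPX, hPα⟩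
  have hX0 : 0 < X := by linarith
  have hP1 := one_le_supNorm hP.ne_zero
  have hQ1 := one_le_supNorm hQ
  have hQζ : 0 < |aeval ζ Q| := abs_pos.mpr (aeval_ne_zero hζ hQ)
  have hXs : 0 < X ^ s := Real.rpow_pos_of_pos hX0 s
  have hXs1 : 1 ≤ X ^ s := Real.one_le_rpow hX hs
  rw [Real.rpow_neg hX0.le] at hPα
  -- the mean value estimate for `P` between `ζ` and its root `α`
  have hPζ : |aeval ζ P| * X ^ s ≤ L := by
    have hα : |ζ - α| ≤ 1 := hPα.trans (mul_le_one₀ (inv_le_one_of_one_le₀ hP1)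
      (inv_nonneg.mpr hXs.le) (inv_le_one_of_one_le₀ hXs1))
    have hαZ : |α| ≤ Z + 1 := by
      have h1 : |ζ| ≤ Z := le_max_right _ _
      have h2 := abs_sub_abs_le_abs_sub α ζ
      rw [abs_sub_comm] at h2
      linarith
    have h1 := abs_eval_sub_eval_le (p := P.map (Int.castRingHom ℝ)) (natDegree_map_le.trans hPn)
      (B := P.supNorm) (Z := Z + 1) (x := ζ) (y := α)
      (fun i => by simpa using abs_coeff_le_supNorm P i) (by linarith)
      ((le_max_right _ _).trans (by linarith [hZ])) hαZ
    rw [← aeval_eq_eval_map, ← aeval_eq_eval_map, hP.2.2, sub_zero] at h1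
    calc |aeval ζ P| * X ^ s
        ≤ (n + 1) * (P.supNorm * (n * (Z + 1) ^ n)) * (P.supNorm⁻¹ * (X ^ s)⁻¹) * X ^ s := by
          gcongr
          exact h1.trans (by gcongr)
      _ = L := by
          have : P.supNorm ≠ 0 := by positivity
          rw [hL]; field_simp
  have hXk : 0 < X ^ k := by positivity
  have hQn : 0 < Q.supNorm ^ n := by positivity
  rcases hP.2.1.isCoprime_or_dvd (Q.map (Int.castRingHom ℚ)) with hcop | hdvd
  · have h1 := one_le_of_isCoprime hP.ne_zero hQ hPn hQk hP.natDegree_pos hcop ζ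
    rw [← hZ] at h1
    -- the choice of `X` makes the term of `Q` equal to at most `1 / 2`
    have h2 : K * (|aeval ζ Q| / Q.supNorm * (Q.supNorm ^ n * P.supNorm ^ k)) ≤ 1 / 2 := by
      calc K * (|aeval ζ Q| / Q.supNorm * (Q.supNorm ^ n * P.supNorm ^ k))
          ≤ K * (|aeval ζ Q| / Q.supNorm * (Q.supNorm ^ n * X ^ k)) := by gcongr
        _ = (X ^ k * (2 * K * |aeval ζ Q| * Q.supNorm ^ n)) / Q.supNorm / 2 := by ring
        _ = 1 / 2 := by rw [hXQ, div_self (by positivity)]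
    have h3 : K * (|aeval ζ P| / P.supNorm * (Q.supNorm ^ n * P.supNorm ^ k)) ≤
        K * (|aeval ζ P| * (Q.supNorm ^ n * X ^ k)) := by
      gcongr
      exact div_le_self (abs_nonneg _) hP1
    have h4 : 1 ≤ 2 * (K * (|aeval ζ P| * (Q.supNorm ^ n * X ^ k))) := by
      have h5 : ((n + k).factorial : ℝ) * (Z ^ (n + k) *
        (|aeval ζ P| / P.supNorm + |aeval ζ Q| / Q.supNorm) * (Q.supNorm ^ n * P.supNorm ^ k)) =
        K * (|aeval ζ P| / P.supNorm * (Q.supNorm ^ n * P.supNorm ^ k)) +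
        K * (|aeval ζ Q| / Q.supNorm * (Q.supNorm ^ n * P.supNorm ^ k)) := by rw [hK]; ring
      linarith
    calc X ^ s = X ^ s * 1 := (mul_one _).symm
      _ ≤ X ^ s * (2 * (K * (|aeval ζ P| * (Q.supNorm ^ n * X ^ k)))) := by gcongr
      _ = 2 * K * (|aeval ζ P| * X ^ s) * (X ^ k * Q.supNorm ^ n) := by ring
      _ ≤ 2 * K * L * (X ^ k * Q.supNorm ^ n) := by gcongr
      _ ≤ _ := by
        refine mul_le_mul_of_nonneg_right ?_ (by positivity)
        have : 0 ≤ 2 * K * L * C₂ := by positivity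
        linarith
  · obtain ⟨R, hR⟩ := (IsPrimitive.Int.dvd_iff_map_cast_dvd_map_cast _ _ hP.1).mpr hdvd
    have hRQ : R ∣ Q := hR ▸ dvd_mul_left _ _
    have h1 : |aeval ζ Q| ≤ |aeval ζ P| * (C₂ * Q.supNorm) := by
      rw [hR, map_mul, abs_mul, ← hR]
      gcongr
      refine (abs_aeval_le ((natDegree_le_of_dvd hRQ hQ).trans hQk) ζ).trans ?_
      calc ((k : ℝ) + 1) * (R.supNorm * Z ^ k)
          ≤ (k + 1) * (2 ^ k * (k + 1) * Q.supNorm * Z ^ k) := by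
            gcongr
            exact supNorm_le_of_dvd hRQ hQ hQk
        _ = C₂ * Q.supNorm := by rw [hC₂]; ring
    have h2 : X ^ s * |aeval ζ Q| ≤ (L * C₂) * Q.supNorm := by
      calc X ^ s * |aeval ζ Q| ≤ X ^ s * (|aeval ζ P| * (C₂ * Q.supNorm)) := by gcongr
        _ = (|aeval ζ P| * X ^ s) * (C₂ * Q.supNorm) := by ring
        _ ≤ L * (C₂ * Q.supNorm) := by gcongr
        _ = _ := by ring
    have h3 : X ^ s ≤ 2 * K * L * C₂ * (X ^ k * Q.supNorm ^ n) := by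
      refine le_of_mul_le_mul_right ?_ hQζ
      calc X ^ s * |aeval ζ Q| ≤ (L * C₂) * Q.supNorm := h2
        _ = (L * C₂) * (X ^ k * (2 * K * |aeval ζ Q| * Q.supNorm ^ n)) := by rw [hXQ]
        _ = _ := by ring
    refine h3.trans (mul_le_mul_of_nonneg_right ?_ (by positivity))
    have : 0 ≤ 2 * K * L := by positivity
    linarith

/-- If `|Q(ζ)| ≤ H(Q)^(-t)` for infinitely many `Q` of degree at most `k`, then no exponent beyond
`k + k n / (t - n + 1)` is admissible for the uniform approximation in degree `n`. -/
lemma le_of_infinite {ζ : ℝ} (hζ : Transcendental ℚ ζ) {k n : ℕ} (hk : 1 ≤ k) {t s : ℝ}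
    (ht : (n : ℝ) ≤ t)
    (hinf : {P : ℤ[X] | P.natDegree ≤ k ∧ 0 < |aeval ζ P| ∧
      |aeval ζ P| ≤ P.supNorm ^ (-t)}.Infinite)
    (hs : ∀ᶠ X : ℝ in atTop, ∃ (α : ℝ) (P : ℤ[X]), IsMinimalPolynomial P α ∧
      P.natDegree ≤ n ∧ P.supNorm ≤ X ∧ |ζ - α| ≤ P.supNorm⁻¹ * X ^ (-s)) :
    s ≤ k + k * n / (t - n + 1) := by
  by_contra! hlt
  obtain ⟨K, C, hK1, hC1, hmain⟩ := exists_rpow_le_mul_pow hζ k n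
  set τ := t - n + 1 with hτ
  have hτ1 : 1 ≤ τ := by linarith
  have hs0 : 0 ≤ s := le_trans (by positivity) hlt.le
  set D : ℝ := C * (2 * K) ^ (n / τ : ℝ) with hD
  have hlarge : ∀ᶠ X : ℝ in atTop, D < X ^ (s - (k + k * n / τ)) :=
    (tendsto_rpow_atTop (by linarith)).eventually_gt_atTop D
  obtain ⟨X₀, hX₀⟩ := eventually_atTop.mp ((hs.and hlarge).and (eventually_ge_atTop 1))
  obtain ⟨Q, ⟨hQk, hQ0, hQt⟩, hQX⟩ : ∃ Q ∈ {P : ℤ[X] | P.natDegree ≤ k ∧ 0 < |aeval ζ P| ∧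
      |aeval ζ P| ≤ P.supNorm ^ (-t)}, 2 * K * max X₀ 0 ^ k < Q.supNorm := by
    by_contra! hcon
    exact hinf ((finite_setOf_supNorm_le k (2 * K * max X₀ 0 ^ k)).subset
      fun Q hQ => ⟨hQ.1, hcon Q hQ⟩)
  have hQ : Q ≠ 0 := by rintro rfl; simp at hQ0
  have hQ1 := one_le_supNorm hQ
  have hH0 : 0 < Q.supNorm := by linarith
  set y := Q.supNorm / (2 * K * |aeval ζ Q| * Q.supNorm ^ n) with hy
  have hy0 : 0 < y := by positivity
  set X := y ^ ((k : ℝ)⁻¹) with hX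
  have hXk : X ^ k = y := Real.rpow_inv_natCast_pow hy0.le (by omega)
  have hXpos : 0 < X := Real.rpow_pos_of_pos hy0 _
  have hHy : Q.supNorm ^ τ ≤ 2 * K * y := by
    rw [hy, mul_div_assoc', le_div_iff₀ (by positivity)]
    have h1 : Q.supNorm ^ τ * Q.supNorm ^ n * Q.supNorm ^ (-t) = Q.supNorm := by
      rw [← Real.rpow_natCast, ← Real.rpow_add hH0, ← Real.rpow_add hH0, hτ]
      convert Real.rpow_one _ using 2
      ring
    calc Q.supNorm ^ τ * (2 * K * |aeval ζ Q| * Q.supNorm ^ n)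
        ≤ Q.supNorm ^ τ * (2 * K * Q.supNorm ^ (-t) * Q.supNorm ^ n) := by gcongr
      _ = 2 * K * (Q.supNorm ^ τ * Q.supNorm ^ n * Q.supNorm ^ (-t)) := by ring
      _ = 2 * K * Q.supNorm := by rw [h1]
  have hXX₀ : X₀ ≤ X := by
    refine (le_max_left X₀ 0).trans (le_of_not_gt fun hcon => ?_)
    have h1 : X ^ k ≤ max X₀ 0 ^ k := by gcongr
    have h2 : Q.supNorm ≤ Q.supNorm ^ τ := Real.self_le_rpow_of_one_le hQ1 hτ1
    rw [hXk] at h1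
    have h3 : 2 * K * y ≤ 2 * K * max X₀ 0 ^ k := by gcongr
    linarith
  obtain ⟨⟨hα, hlarge'⟩, hX1⟩ := hX₀ X hXX₀
  have h1 := hmain Q X s hQ hQk hX1 hs0 (by rw [hXk, hy]; field_simp) hα
  have h2 : Q.supNorm ^ n ≤ (2 * K) ^ (n / τ : ℝ) * X ^ (k * n / τ : ℝ) := by
    calc Q.supNorm ^ n = (Q.supNorm ^ τ) ^ (n / τ : ℝ) := by
          rw [← Real.rpow_mul hH0.le, mul_div_cancel₀ _ (by positivity), Real.rpow_natCast]
      _ ≤ (2 * K * y) ^ (n / τ : ℝ) := by gcongr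
      _ = (2 * K) ^ (n / τ : ℝ) * X ^ (k * n / τ : ℝ) := by
          rw [Real.mul_rpow (by positivity) hy0.le, ← hXk, ← Real.rpow_natCast,
            ← Real.rpow_mul hXpos.le, mul_div_assoc]
  have h3 : X ^ s ≤ D * X ^ (k + k * n / τ : ℝ) := by
    calc X ^ s ≤ C * (X ^ k * Q.supNorm ^ n) := h1
      _ ≤ C * (X ^ k * ((2 * K) ^ (n / τ : ℝ) * X ^ (k * n / τ : ℝ))) := by gcongr
      _ = D * X ^ (k + k * n / τ : ℝ) := by
          rw [Real.rpow_add hXpos, Real.rpow_natCast, hD]; ring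
  rw [Real.rpow_sub hXpos, lt_div_iff₀ (Real.rpow_pos_of_pos hXpos _)] at hlarge'
  linarith

/-! ### Integer polynomials with small values -/

/-- Dirichlet's theorem, by the pigeonhole principle on the values at `ζ`. -/
lemma exists_small_value (ζ : ℝ) {n : ℕ} (hn : 1 ≤ n) :
    ∃ C : ℝ, 0 < C ∧ ∀ X : ℝ, 1 ≤ X → ∃ A : ℤ[X], A ≠ 0 ∧ A.natDegree ≤ n ∧ A.supNorm ≤ X ∧
      |aeval ζ A| ≤ C / X ^ n := by
  set L : ℝ := ∑ i : Fin (n + 1), |ζ| ^ (i : ℕ) with hL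
  have hL1 : 1 ≤ L := by
    rw [hL, Fin.sum_univ_succ]
    have : 0 ≤ ∑ i : Fin n, |ζ| ^ ((i.succ : Fin (n + 1)) : ℕ) :=
      Finset.sum_nonneg fun _ _ => by positivity
    simpa using this
  refine ⟨4 * L, by positivity, fun X hX => ?_⟩
  set Y := ⌊X⌋₊ with hY
  have hY1 : 1 ≤ Y := Nat.le_floor (by simpa using hX)
  have hYX : (Y : ℝ) ≤ X := Nat.floor_le (by linarith)
  have hXY : X < Y + 1 := Nat.lt_floor_add_one X
  have hY1' : (1 : ℝ) ≤ Y := by exact_mod_cast hY1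
  let v : (Fin (n + 1) → Fin (Y + 1)) → ℝ := fun f => ∑ i, ((f i : ℕ) : ℝ) * ζ ^ (i : ℕ)
  have hv : ∀ f, |v f| ≤ L * Y := fun f => by
    refine (Finset.abs_sum_le_sum_abs _ _).trans ?_
    rw [hL, Finset.sum_mul]
    refine Finset.sum_le_sum fun i _ => ?_
    rw [abs_mul, abs_pow, mul_comm, Nat.abs_cast]
    gcongr
    exact Nat.lt_succ_iff.mp (f i).2
  set R : ℝ := Y * (Y + 1) ^ n / 4 with hR
  have hscale : ∀ f, |v f * ((Y + 1) ^ n / (4 * L))| ≤ R := fun f => by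
    rw [abs_mul, abs_of_nonneg (a := ((Y : ℝ) + 1) ^ n / (4 * L)) (by positivity)]
    calc |v f| * ((Y + 1) ^ n / (4 * L)) ≤ L * Y * ((Y + 1) ^ n / (4 * L)) := by
          gcongr
          exact hv f
      _ = R := by rw [hR]; field_simp
  let g : (Fin (n + 1) → Fin (Y + 1)) → ℤ := fun f => ⌊v f * ((Y + 1) ^ n / (4 * L))⌋
  have hg : Set.MapsTo g (Finset.univ : Finset (Fin (n + 1) → Fin (Y + 1)))
      (Finset.Icc ⌊-R⌋ ⌊R⌋) := fun f _ => by
    have := abs_le.mp (hscale f)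
    exact Finset.mem_coe.mpr (Finset.mem_Icc.mpr ⟨Int.floor_mono this.1, Int.floor_mono this.2⟩)
  have hcard : (Finset.Icc ⌊-R⌋ ⌊R⌋).card <
      (Finset.univ : Finset (Fin (n + 1) → Fin (Y + 1))).card := by
    have hR0 : 0 ≤ R := by positivity
    have h1 : (((Finset.Icc ⌊-R⌋ ⌊R⌋).card : ℤ) : ℝ) ≤ 2 * R + 2 := by
      rw [Int.card_Icc, Int.toNat_of_nonneg]
      · push_cast
        linarith [Int.floor_le R, Int.lt_floor_add_one (-R)]
      · have := Int.floor_mono (a := -R) (b := R) (by linarith)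
        linarith
    have h2 : (2 : ℝ) ≤ (Y + 1) ^ n := by
      calc (2 : ℝ) ≤ Y + 1 := by linarith
        _ ≤ (Y + 1) ^ n := le_self_pow₀ (by linarith) (by omega)
    have h3 : 2 * R + 2 < (Y + 1) ^ n * (Y + 1) := by rw [hR]; nlinarith
    have h4 : ((Finset.univ : Finset (Fin (n + 1) → Fin (Y + 1))).card : ℝ) =
        (Y + 1) ^ n * (Y + 1) := by
      simp [pow_succ]
    rw [← Nat.cast_lt (α := ℝ), h4]
    exact_mod_cast h1.trans_lt h3
  obtain ⟨f₁, -, f₂, -, hne, heq⟩ :=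
    Finset.exists_ne_map_eq_of_card_lt_of_maps_to hcard hg
  let A : ℤ[X] := ofFn (n + 1) fun i => ((f₁ i : ℕ) : ℤ) - (f₂ i : ℕ)
  have hAcoeff : ∀ i : Fin (n + 1), A.coeff i = ((f₁ i : ℕ) : ℤ) - (f₂ i : ℕ) := fun i =>
    ofFn_coeff_eq_val_of_lt _ i.2
  have hAdeg : A.natDegree < n + 1 := ofFn_natDegree_lt (by omega) _
  refine ⟨A, fun h0 => hne (funext fun i => ?_), by omega, supNorm_le_of_forall fun i => ?_, ?_⟩
  · have := hAcoeff i
    rw [h0, coeff_zero] at this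
    exact Fin.ext (by omega)
  · rcases lt_or_ge i (n + 1) with hi | hi
    · refine le_trans ?_ hYX
      have h1 := hAcoeff ⟨i, hi⟩
      simp only at h1
      have h2 := (f₁ ⟨i, hi⟩).2
      have h3 := (f₂ ⟨i, hi⟩).2
      have h4 : |A.coeff i| ≤ (Y : ℤ) := by
        rw [h1, abs_le]
        constructor <;> omega
      exact_mod_cast h4
    · rw [coeff_eq_zero_of_natDegree_lt (by omega)]
      simp
      linarith
  · have hval : aeval ζ A = v f₁ - v f₂ := by
      rw [aeval_eq_eval_map, eval_eq_sum_range' (natDegree_map_le.trans_lt hAdeg),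
        ← Fin.sum_univ_eq_sum_range (fun i : ℕ => (A.map (Int.castRingHom ℝ)).coeff i * ζ ^ i)
        (n + 1), ← Finset.sum_sub_distrib]
      refine Finset.sum_congr rfl fun i _ => ?_
      rw [coeff_map, hAcoeff]
      simp [sub_mul]
    have h1 := Int.abs_sub_lt_one_of_floor_eq_floor heq
    rw [← sub_mul, ← hval, abs_mul,
      abs_of_nonneg (a := ((Y : ℝ) + 1) ^ n / (4 * L)) (by positivity), mul_div_assoc',
      div_lt_one (by positivity)] at h1
    rw [le_div_iff₀ (by positivity)]
    refine le_trans ?_ h1.le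
    gcongr

/-- Removing from `A` all factors of degree at most `k`: if integer polynomials of degree at most
`k` do not take very small values at `ζ`, neither does the part `A₀` which is removed, uniformly in
the number of factors. -/
lemma exists_factorization {ζ c W : ℝ} {k : ℕ} (hc0 : 0 < c) (hc1 : c ≤ 1)
    (hlow : ∀ P : ℤ[X], P ≠ 0 → P.natDegree ≤ k → c * mahler P ^ (-W) ≤ |aeval ζ P|) (d : ℕ) :
    ∀ A : ℤ[X], A ≠ 0 → A.natDegree ≤ d → ∃ A₀ A₁ : ℤ[X], A = A₀ * A₁ ∧
      c ^ d * mahler A₀ ^ (-W) ≤ |aeval ζ A₀| ∧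
      ∀ p : ℤ[X], Irreducible p → p ∣ A₁ → 0 < p.natDegree → k < p.natDegree := by
  have htriv : ∀ (d : ℕ) (A : ℤ[X]),
      (∀ p : ℤ[X], Irreducible p → p ∣ A → 0 < p.natDegree → k < p.natDegree) →
      ∃ A₀ A₁ : ℤ[X], A = A₀ * A₁ ∧ c ^ d * mahler A₀ ^ (-W) ≤ |aeval ζ A₀| ∧
      ∀ p : ℤ[X], Irreducible p → p ∣ A₁ → 0 < p.natDegree → k < p.natDegree :=
    fun d A h => ⟨1, A, (one_mul A).symm, by simpa [mahler] using pow_le_one₀ hc0.le hc1, h⟩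
  induction d with
  | zero =>
    refine fun A hA hd => htriv 0 A fun p _ hpA hp => ?_
    have := natDegree_le_of_dvd hpA hA
    omega
  | succ d ih =>
    intro A hA hd
    by_cases h : ∀ p : ℤ[X], Irreducible p → p ∣ A → 0 < p.natDegree → k < p.natDegree
    · exact htriv _ A h
    · push Not at h
      obtain ⟨p, -, ⟨B, rfl⟩, hp0, hpk⟩ := h
      have hp := left_ne_zero_of_mul hA
      have hB := right_ne_zero_of_mul hA
      rw [natDegree_mul hp hB] at hd
      obtain ⟨A₀, A₁, rfl, h1, h2⟩ := ih B hB (by omega)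
      refine ⟨p * A₀, A₁, (mul_assoc _ _ _).symm, ?_, h2⟩
      have hm : ∀ P : ℤ[X], 0 ≤ mahler P := fun P => mahlerMeasure_nonneg _
      rw [map_mul, abs_mul, mahler_mul, Real.mul_rpow (hm p) (hm A₀)]
      calc c ^ (d + 1) * (mahler p ^ (-W) * mahler A₀ ^ (-W))
          = (c * mahler p ^ (-W)) * (c ^ d * mahler A₀ ^ (-W)) := by ring
        _ ≤ |aeval ζ p| * |aeval ζ A₀| :=
          mul_le_mul (hlow p hp hpk) h1 (mul_nonneg (by positivity) (Real.rpow_nonneg (hm A₀) _))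
            (abs_nonneg _)

lemma isCoprime_of_forall_natDegree_lt {A Q : ℤ[X]} {k : ℕ} (hA : A ≠ 0) (hQ : Q ≠ 0)
    (hQk : Q.natDegree ≤ k)
    (h : ∀ p : ℤ[X], Irreducible p → p ∣ A → 0 < p.natDegree → k < p.natDegree) :
    IsCoprime (A.map (Int.castRingHom ℚ)) (Q.map (Int.castRingHom ℚ)) := by
  have hinj : Function.Injective (Int.castRingHom ℚ) := (Int.castRingHom ℚ).injective_int
  refine isCoprime_of_prime_dvd
    (fun h0 => hA ((Polynomial.map_eq_zero_iff hinj).mp h0.1)) fun z hz hzA hzQ => ?_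
  obtain ⟨p, hp, hpA, hzp⟩ := exists_irreducible_dvd_of_prime_dvd_map _ hz hA hzA
  have hp0 : 0 < p.natDegree := by
    have h1 : 0 < z.natDegree := hz.irreducible.natDegree_pos
    have h2 := natDegree_le_of_dvd hzp
      (fun h0 => hp.ne_zero ((Polynomial.map_eq_zero_iff hinj).mp h0))
    exact (h1.trans_le h2).trans_le natDegree_map_le
  have hpirr := (IsPrimitive.Int.irreducible_iff_irreducible_map_cast
    (hp.isPrimitive hp0.ne')).mp hp
  have h1 : p.map (Int.castRingHom ℚ) ∣ Q.map (Int.castRingHom ℚ) :=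
    (hz.irreducible.associated_of_dvd hpirr hzp).symm.dvd.trans hzQ
  have h2 := natDegree_le_of_dvd h1 (fun h0 => hQ ((Polynomial.map_eq_zero_iff hinj).mp h0))
  rw [natDegree_map_eq_of_injective hinj, natDegree_map_eq_of_injective hinj] at h2
  exact absurd (h p hp hpA hp0) (by omega)

/-! ### Real algebraic numbers from two coprime polynomials -/

lemma exists_mul_add_mul_eq {f g G : ℝ[X]} (h : IsCoprime f g) (hf : 0 < f.natDegree)
    (hg : 0 < g.natDegree) (hG : G.natDegree < f.natDegree + g.natDegree) :
    ∃ u v : ℝ[X], u.natDegree < g.natDegree ∧ v.natDegree < f.natDegree ∧ u * f + v * g = G := by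
  obtain ⟨a, b, hab⟩ := h
  have hf0 : f ≠ 0 := by rintro rfl; simp at hf
  have hg0 : g ≠ 0 := by rintro rfl; simp at hg
  have hu : ((a * G) % g).natDegree < g.natDegree := natDegree_mod_lt _ hg.ne'
  have hdvd : g ∣ G - (a * G) % g * f := by
    have h1 : (a * G) % g = a * G - g * (a * G / g) := by
      rw [eq_sub_iff_add_eq, add_comm]
      exact EuclideanDomain.div_add_mod _ _
    rw [h1]
    exact ⟨b * G + (a * G / g) * f, by linear_combination (-G) * hab⟩
  obtain ⟨v, hv⟩ := hdvd
  refine ⟨_, v, hu, ?_, by rw [mul_comm v, ← hv]; ring⟩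
  by_cases hv0 : v = 0
  · simpa [hv0] using hf
  have h1 : (g * v).natDegree < f.natDegree + g.natDegree := by
    rw [← hv]
    refine (natDegree_sub_le _ _).trans_lt (max_lt hG (natDegree_mul_le.trans_lt ?_))
    omega
  rw [natDegree_mul hg0 hv0] at h1
  omega

lemma exists_int_polynomial_near (u : ℝ[X]) :
    ∃ U : ℤ[X], (u - U.map (Int.castRingHom ℝ)).natDegree ≤ u.natDegree ∧
      ∀ i, |(u - U.map (Int.castRingHom ℝ)).coeff i| ≤ 1 := by
  let U : ℤ[X] := ∑ i ∈ Finset.range (u.natDegree + 1), monomial i ⌊u.coeff i⌋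
  have hU : ∀ i, U.coeff i = if i < u.natDegree + 1 then ⌊u.coeff i⌋ else 0 := fun i => by
    simp [U, coeff_monomial]
  have hUd : U.natDegree ≤ u.natDegree := by
    rw [natDegree_le_iff_coeff_eq_zero]
    intro i hi
    rw [hU, if_neg (by omega)]
  refine ⟨U, (natDegree_sub_le _ _).trans (max_le le_rfl (natDegree_map_le.trans hUd)),
    fun i => ?_⟩
  rw [coeff_sub, coeff_map, hU]
  split_ifs with hi
  · rw [eq_intCast, Int.self_sub_floor, abs_of_nonneg (Int.fract_nonneg _)]
    exact (Int.fract_lt_one _).le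
  · rw [coeff_eq_zero_of_natDegree_lt (by omega)]
    simp

lemma abs_coeff_mul_le {e f : ℝ[X]} {N : ℕ} {B : ℝ} (he : ∀ i, |e.coeff i| ≤ 1)
    (hf : ∀ i, |f.coeff i| ≤ B) (hN : (e * f).natDegree ≤ N) (i : ℕ) :
    |(e * f).coeff i| ≤ (N + 1) * B := by
  have hB : 0 ≤ B := (abs_nonneg _).trans (hf 0)
  rcases lt_or_ge N i with hi | hi
  · rw [coeff_eq_zero_of_natDegree_lt (by omega), abs_zero]
    positivity
  · rw [coeff_mul]
    refine (Finset.abs_sum_le_sum_abs _ _).trans ?_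
    refine (Finset.sum_le_card_nsmul _ _ B fun x _ => ?_).trans ?_
    · rw [abs_mul]
      exact (mul_le_mul (he _) (hf _) (abs_nonneg _) zero_le_one).trans_eq (one_mul _)
    · rw [Finset.Nat.card_antidiagonal, nsmul_eq_mul]
      gcongr
      exact_mod_cast Nat.succ_le_succ hi

lemma exists_isMinimalPolynomial_dvd {F : ℤ[X]} (hF : F ≠ 0) {α : ℝ} (h : aeval α F = 0) :
    ∃ P : ℤ[X], IsMinimalPolynomial P α ∧ P ∣ F := by
  rw [aeval_eq_eval_map] at h
  obtain ⟨P, hP, hPF, hdvd⟩ := exists_irreducible_dvd_of_prime_dvd_map (Int.castRingHom ℝ)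
    (prime_X_sub_C α) hF (dvd_iff_isRoot.mpr h)
  have hα : aeval α P = 0 := by
    rw [aeval_eq_eval_map]
    exact dvd_iff_isRoot.mp hdvd
  have h0 : P.natDegree ≠ 0 := fun h0 => by
    have h1 := eq_C_of_natDegree_eq_zero h0
    rw [h1] at hα
    simp only [eq_intCast, map_intCast, Int.cast_eq_zero] at hα
    rw [hα] at h1
    exact hP.ne_zero (by simpa using h1)
  have hprim := hP.isPrimitive h0
  exact ⟨P, ⟨hprim, (IsPrimitive.Int.irreducible_iff_irreducible_map_cast hprim).mp hP, hα⟩, hPF⟩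

/-- Two coprime integer polynomials `A`, `Q` with values at most `ε` at `ζ` yield a real algebraic
number within `O(ε / X)` of `ζ`. Indeed a real multiple of `X (T - ζ)` is a combination
`u A + v Q` of low degree, and rounding the coefficients of `u` and `v` to integers perturbs it by
little near `ζ`, so that there remains a sign change. -/
lemma exists_isMinimalPolynomial_near (ζ : ℝ) (N : ℕ) {B : ℝ} (hB : 0 ≤ B) :
    ∃ D : ℝ, 0 < D ∧ ∀ (X ε : ℝ) (A Q : ℤ[X]), 1 ≤ X → 0 < ε → ε ≤ X →
      IsCoprime (A.map (Int.castRingHom ℚ)) (Q.map (Int.castRingHom ℚ)) →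
      0 < A.natDegree → 0 < Q.natDegree → A.natDegree + Q.natDegree ≤ N + 1 →
      A.supNorm ≤ B * X → Q.supNorm ≤ B * X → |aeval ζ A| ≤ ε → |aeval ζ Q| ≤ ε →
      ∃ (α : ℝ) (P : ℤ[X]), IsMinimalPolynomial P α ∧ P.natDegree ≤ N ∧ P.supNorm ≤ D * X ∧
        |ζ - α| ≤ D * ε / X := by
  set Z := max 1 |ζ| with hZ
  have hZ1 : 1 ≤ Z := le_max_left _ _
  set B' : ℝ := 2 * ((N + 1) * B) with hB'
  set s₀ : ℝ := 2 * ((N + 1) * Z ^ N) with hs₀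
  have hs₀0 : 0 ≤ s₀ := by positivity
  set Z₁ := Z + (s₀ + 1) with hZ₁
  set l₀ : ℝ := (N + 1) * (B' * (N * Z₁ ^ N)) with hl₀
  have hl₀0 : 0 ≤ l₀ := by positivity
  set D₁ : ℝ := (l₀ + 1) * (1 + |ζ|) + B' with hD₁
  have hD₁0 : 0 ≤ D₁ := by positivity
  have hfac : 0 ≤ (2 : ℝ) ^ N * (N + 1) * D₁ := by positivity
  refine ⟨2 ^ N * (N + 1) * D₁ + (s₀ + 1), by positivity, ?_⟩
  intro X ε A Q hX hε hεX hcop hA0 hQ0 hN hAB hQB hAε hQε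
  have hXpos : 0 < X := by linarith
  have hinj : Function.Injective (Int.castRingHom ℝ) := (Int.castRingHom ℝ).injective_int
  set f := A.map (Int.castRingHom ℝ) with hf
  set g := Q.map (Int.castRingHom ℝ) with hg
  have hfd : f.natDegree = A.natDegree := natDegree_map_eq_of_injective hinj _
  have hgd : g.natDegree = Q.natDegree := natDegree_map_eq_of_injective hinj _
  have hcop' : IsCoprime f g := by
    have h1 := hcop.map (mapRingHom (algebraMap ℚ ℝ))
    simp only [coe_mapRingHom, Polynomial.map_map] at h1
    rwa [RingHom.ext_int ((algebraMap ℚ ℝ).comp (Int.castRingHom ℚ)) (Int.castRingHom ℝ)] at h1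
  set G : ℝ[X] := C ((l₀ + 1) * X) * (Polynomial.X - C ζ) with hG
  have hGd : G.natDegree ≤ 1 := (natDegree_C_mul_le _ _).trans (natDegree_X_sub_C_le ζ)
  obtain ⟨u, v, hud, hvd, huv⟩ := exists_mul_add_mul_eq hcop' (by omega) (by omega)
    (hGd.trans_lt (by omega))
  obtain ⟨U, hUd, hU⟩ := exists_int_polynomial_near u
  obtain ⟨V, hVd, hV⟩ := exists_int_polynomial_near v
  set eu := u - U.map (Int.castRingHom ℝ) with heu
  set ev := v - V.map (Int.castRingHom ℝ) with hev
  set E := eu * f + ev * g with hE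
  set F : ℤ[X] := U * A + V * Q with hF
  have hFE : F.map (Int.castRingHom ℝ) = G - E := by
    rw [hF, Polynomial.map_add, Polynomial.map_mul, Polynomial.map_mul, ← huv, hE, heu, hev]
    ring
  have hd1 : (eu * f).natDegree ≤ N := natDegree_mul_le.trans (by omega)
  have hd2 : (ev * g).natDegree ≤ N := natDegree_mul_le.trans (by omega)
  have hEd : E.natDegree ≤ N := (natDegree_add_le _ _).trans (max_le hd1 hd2)
  have hEc : ∀ i, |E.coeff i| ≤ B' * X := fun i => by
    have h1 := abs_coeff_mul_le hU (B := B * X) (f := f)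
      (fun i => by simpa [hf] using (abs_coeff_le_supNorm A i).trans hAB) hd1 i
    have h2 := abs_coeff_mul_le hV (B := B * X) (f := g)
      (fun i => by simpa [hg] using (abs_coeff_le_supNorm Q i).trans hQB) hd2 i
    rw [hE, coeff_add]
    refine (abs_add_le _ _).trans ((add_le_add h1 h2).trans_eq ?_)
    rw [hB']; ring
  have hEζ : |E.eval ζ| ≤ s₀ * ε := by
    have hval : ∀ (e : ℝ[X]) (w : ℝ), e.natDegree ≤ N → (∀ i, |e.coeff i| ≤ 1) → |w| ≤ ε →
        |e.eval ζ * w| ≤ (N + 1) * Z ^ N * ε := fun e w hd hc hw => by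
      have h1 := abs_eval_le hd hc hZ1 (le_max_right 1 |ζ|)
      rw [abs_mul]
      rw [one_mul] at h1
      exact mul_le_mul h1 hw (abs_nonneg _) (by positivity)
    rw [hE, eval_add, eval_mul, eval_mul]
    refine (abs_add_le _ _).trans ((add_le_add
      (hval eu _ (by omega) hU (by rwa [hf, ← aeval_eq_eval_map]))
      (hval ev _ (by omega) hV (by rwa [hg, ← aeval_eq_eval_map]))).trans_eq ?_)
    rw [hs₀]; ring
  -- at distance `h` from `ζ` the linear term `G` dominates the perturbation `E`
  set h := (s₀ + 1) * ε / X with hh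
  have hh0 : 0 < h := by positivity
  have hh1 : h ≤ s₀ + 1 := by
    rw [hh, div_le_iff₀ hXpos]
    gcongr
  have hXh : X * h = (s₀ + 1) * ε := by rw [hh]; field_simp
  have hEh : ∀ y, |y - ζ| ≤ h → |E.eval y| ≤ s₀ * ε + l₀ * X * h := fun y hy => by
    have hζZ : |ζ| ≤ Z := le_max_right _ _
    have h1 := abs_eval_sub_eval_le (x := y) (y := ζ) (Z := Z₁) hEd hEc (by linarith)
      (by linarith [abs_sub_abs_le_abs_sub y ζ]) (by linarith)
    have h2 : |E.eval y| - |E.eval ζ| ≤ |E.eval y - E.eval ζ| := abs_sub_abs_le_abs_sub _ _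
    have h3 : (N + 1) * (B' * X * (N * Z₁ ^ N)) * |y - ζ| ≤ l₀ * X * h := by
      calc (N + 1) * (B' * X * (N * Z₁ ^ N)) * |y - ζ| = l₀ * X * |y - ζ| := by rw [hl₀]; ring
        _ ≤ l₀ * X * h := by gcongr
    linarith
  have hFeval : ∀ y, (F.map (Int.castRingHom ℝ)).eval y = (l₀ + 1) * X * (y - ζ) - E.eval y :=
    fun y => by simp [hFE, hG]
  have hpos : 0 < (F.map (Int.castRingHom ℝ)).eval (ζ + h) := by
    have h1 := abs_le.mp (hEh (ζ + h) (by simp [abs_of_pos hh0]))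
    rw [hFeval]
    nlinarith [h1.2]
  have hneg : (F.map (Int.castRingHom ℝ)).eval (ζ - h) < 0 := by
    have h1 := abs_le.mp (hEh (ζ - h) (by simp [abs_of_pos hh0]))
    rw [hFeval]
    nlinarith [h1.1]
  have hF0 : F ≠ 0 := fun h0 => by simp [h0] at hpos
  obtain ⟨α, hα, hFα⟩ := intermediate_value_Icc (by linarith : ζ - h ≤ ζ + h)
    (F.map (Int.castRingHom ℝ)).continuous.continuousOn ⟨hneg.le, hpos.le⟩
  obtain ⟨P, hP, hPF⟩ := exists_isMinimalPolynomial_dvd hF0 ((aeval_eq_eval_map F α).trans hFα)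
  have hFd : F.natDegree ≤ N := by
    rw [← natDegree_map_eq_of_injective hinj F, hFE]
    exact (natDegree_sub_le _ _).trans (max_le (hGd.trans (by omega)) hEd)
  have hFH : F.supNorm ≤ D₁ * X := supNorm_le_of_forall fun i => by
    have h1 : ((F.coeff i : ℤ) : ℝ) = G.coeff i - E.coeff i := by
      rw [← coeff_sub, ← hFE, coeff_map, eq_intCast]
    have h2 : |G.coeff i| ≤ (l₀ + 1) * X * (1 + |ζ|) := by
      rw [hG, coeff_C_mul, abs_mul, abs_of_nonneg (a := (l₀ + 1) * X) (by positivity)]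
      gcongr
      rw [coeff_sub]
      refine (abs_sub _ _).trans (add_le_add ?_ ?_)
      · rw [coeff_X]; split_ifs <;> simp
      · rw [coeff_C]; split_ifs <;> simp
    rw [h1]
    refine (abs_sub _ _).trans ((add_le_add h2 (hEc i)).trans_eq ?_)
    rw [hD₁]; ring
  refine ⟨α, P, hP, (natDegree_le_of_dvd hPF hF0).trans hFd, ?_, ?_⟩
  · calc P.supNorm ≤ 2 ^ N * (N + 1) * F.supNorm := supNorm_le_of_dvd hPF hF0 hFd
      _ ≤ 2 ^ N * (N + 1) * (D₁ * X) := by gcongr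
      _ = (2 ^ N * (N + 1) * D₁) * X := by ring
      _ ≤ _ := by gcongr; linarith
  · have h1 : |ζ - α| ≤ h := abs_le.mpr ⟨by linarith [hα.2], by linarith [hα.1]⟩
    exact h1.trans (div_le_div_of_nonneg_right
      (mul_le_mul_of_nonneg_right (by linarith) hε.le) hXpos.le)

/-! ### Lower bound for the uniform exponent -/

/-- A bound `w_k(ζ) < W` in quantitative form. The finitely many exceptions are absorbed into `c`,
and the height is replaced by the Mahler measure so that the bound can be multiplied over factors. -/
lemma exists_pos_mul_mahler_rpow_le {ζ : ℝ} (hζ : Transcendental ℚ ζ) {k : ℕ} {W : ℝ}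
    (hW : 0 ≤ W) (h : w k ζ < W) :
    ∃ c : ℝ, 0 < c ∧ c ≤ 1 ∧
      ∀ P : ℤ[X], P ≠ 0 → P.natDegree ≤ k → c * mahler P ^ (-W) ≤ |aeval ζ P| := by
  have hfin : {P : ℤ[X] | P.natDegree ≤ k ∧ 0 < |aeval ζ P| ∧
      |aeval ζ P| ≤ P.supNorm ^ (-W)}.Finite := by
    by_contra hinf
    exact absurd (le_sSup (Set.mem_image_of_mem _ hinf)) (not_le_of_gt h)
  obtain ⟨c, hc0, hc1, hc⟩ : ∃ c : ℝ, 0 < c ∧ c ≤ 1 ∧ ∀ P ∈ {P : ℤ[X] | P.natDegree ≤ k ∧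
      0 < |aeval ζ P| ∧ |aeval ζ P| ≤ P.supNorm ^ (-W)}, c ≤ |aeval ζ P| := by
    have hev : ∀ᶠ c : ℝ in 𝓝[>] 0, ∀ P ∈ {P : ℤ[X] | P.natDegree ≤ k ∧
        0 < |aeval ζ P| ∧ |aeval ζ P| ≤ P.supNorm ^ (-W)}, c ≤ |aeval ζ P| :=
      (eventually_all_finite hfin).mpr fun P hP =>
        eventually_nhdsWithin_of_eventually_nhds (eventually_le_nhds hP.2.1)
    obtain ⟨c, ⟨h1, h2⟩, h3⟩ := ((hev.and (eventually_nhdsWithin_of_eventually_nhds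
      (eventually_le_nhds one_pos))).and self_mem_nhdsWithin).exists
    exact ⟨c, h3, h2, h1⟩
  have hk0 : (0 : ℝ) < 2 ^ k := by positivity
  have hk1 : ((2 : ℝ) ^ k) ^ (-W) ≤ 1 :=
    Real.rpow_le_one_of_one_le_of_nonpos (one_le_pow₀ one_le_two) (by linarith)
  have hkpos : 0 < ((2 : ℝ) ^ k) ^ (-W) := Real.rpow_pos_of_pos hk0 _
  refine ⟨c * ((2 : ℝ) ^ k) ^ (-W), by positivity, mul_le_one₀ hc1 hkpos.le hk1,
    fun P hP hPk => ?_⟩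
  have hH1 := one_le_supNorm hP
  have hm1 := one_le_mahler hP
  have h1 : ((2 : ℝ) ^ k) ^ (-W) * mahler P ^ (-W) ≤ P.supNorm ^ (-W) := by
    rw [← Real.mul_rpow hk0.le (by linarith)]
    exact Real.rpow_le_rpow_of_nonpos (by linarith) (supNorm_le_mul_mahler hPk) (by linarith)
  have h2 : P.supNorm ^ (-W) ≤ 1 := Real.rpow_le_one_of_one_le_of_nonpos hH1 (by linarith)
  have h3 : 0 < P.supNorm ^ (-W) := Real.rpow_pos_of_pos (by linarith) _
  rw [mul_assoc]
  by_cases hPS : |aeval ζ P| ≤ P.supNorm ^ (-W)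
  · refine le_trans ?_ (hc P ⟨hPk, abs_pos.mpr (aeval_ne_zero hζ hP), hPS⟩)
    exact mul_le_of_le_one_right hc0.le (h1.trans h2)
  · exact (mul_le_of_le_one_left (by positivity) hc1).trans (h1.trans (not_le.mp hPS).le)

lemma natDegree_pos_of_abs_aeval_lt_one {P : ℤ[X]} (hP : P ≠ 0) {x : ℝ} (h : |aeval x P| < 1) :
    0 < P.natDegree := by
  by_contra h0
  have h1 := eq_C_of_natDegree_eq_zero (Nat.eq_zero_of_not_pos h0)
  have h2 : P.coeff 0 ≠ 0 := fun h2 => hP (by rw [h1, h2, C_0])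
  rw [h1] at h
  simp only [eq_intCast, map_intCast] at h
  exact absurd (Int.one_le_abs h2) (not_le_of_gt (by exact_mod_cast h))

/-- If integer polynomials of degree at most `k` do not take very small values at `ζ`, then for each
large `X` there are two coprime polynomials of bounded degree with height `O(X)` and value
`O(X^(-k))`: one of degree at most `k` from Dirichlet's theorem, and the other from Dirichlet's
theorem in a larger degree `M`, with its factors of degree at most `k` removed. -/
lemma exists_coprime_small_values {ζ c W : ℝ} {k M : ℕ} (hk : 1 ≤ k)
    (hW : 0 ≤ W) (hM : W + k ≤ M) (hc0 : 0 < c) (hc1 : c ≤ 1)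
    (hlow : ∀ P : ℤ[X], P ≠ 0 → P.natDegree ≤ k → c * mahler P ^ (-W) ≤ |aeval ζ P|) :
    ∃ B D : ℝ, 0 ≤ B ∧ 0 < D ∧ ∀ X : ℝ, 1 ≤ X → ∃ A Q : ℤ[X], A ≠ 0 ∧ Q ≠ 0 ∧
      IsCoprime (A.map (Int.castRingHom ℚ)) (Q.map (Int.castRingHom ℚ)) ∧
      A.natDegree ≤ M ∧ Q.natDegree ≤ k ∧ A.supNorm ≤ B * X ∧ Q.supNorm ≤ B * X ∧
      |aeval ζ A| ≤ D / X ^ k ∧ |aeval ζ Q| ≤ D / X ^ k := by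
  have hM1 : 1 ≤ M := by
    have : (1 : ℝ) ≤ k := by exact_mod_cast hk
    exact_mod_cast (by linarith : (1 : ℝ) ≤ M)
  obtain ⟨C₁, hC₁, h₁⟩ := exists_small_value ζ hk
  obtain ⟨C₂, hC₂, h₂⟩ := exists_small_value ζ hM1
  set C₃ : ℝ := C₂ / c ^ M * (M + 1) ^ W with hC₃
  have hC₃0 : 0 < C₃ := by positivity
  refine ⟨2 ^ M * (M + 1), C₁ + C₃, by positivity, by positivity, fun X hX => ?_⟩
  have hX0 : 0 < X := by linarith
  obtain ⟨Q, hQ, hQk, hQX, hQζ⟩ := h₁ X hX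
  obtain ⟨A, hA, hAM, hAX, hAζ⟩ := h₂ X hX
  obtain ⟨A₀, A₁, hA01, hA₀, hA₁⟩ := exists_factorization hc0 hc1 hlow M A hA hAM
  have hA₀0 : A₀ ≠ 0 := by rintro rfl; simp at hA01; exact hA hA01
  have hA₁0 : A₁ ≠ 0 := by rintro rfl; simp at hA01; exact hA hA01
  have hdvd : A₁ ∣ A := hA01 ▸ dvd_mul_left _ _
  have hdvd₀ : A₀ ∣ A := hA01 ▸ dvd_mul_right _ _
  refine ⟨A₁, Q, hA₁0, hQ, isCoprime_of_forall_natDegree_lt hA₁0 hQ hQk hA₁,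
    (natDegree_le_of_dvd hdvd hA).trans hAM, hQk, ?_, ?_, ?_, ?_⟩
  · exact (supNorm_le_of_dvd hdvd hA hAM).trans (by gcongr)
  · refine hQX.trans (le_mul_of_one_le_left hX0.le ?_)
    exact one_le_mul_of_one_le_of_one_le (one_le_pow₀ one_le_two)
      (by linarith [(Nat.cast_nonneg M : (0 : ℝ) ≤ M)])
  · have hm : mahler A₀ ≤ (M + 1) * X := by
      refine (mahler_le_of_dvd hdvd₀ hA).trans ((mahler_le_mul_supNorm hAM).trans ?_)
      gcongr
    have hm1 := one_le_mahler hA₀0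
    have hA₀' : c ^ M * ((M + 1) * X) ^ (-W) ≤ |aeval ζ A₀| := by
      refine le_trans (mul_le_mul_of_nonneg_left ?_ (by positivity)) hA₀
      exact Real.rpow_le_rpow_of_nonpos (by linarith) hm (by linarith)
    have hpos : 0 < c ^ M * (((M : ℝ) + 1) * X) ^ (-W) := by positivity
    have hprod : |aeval ζ A₁| * (c ^ M * ((M + 1) * X) ^ (-W)) ≤ C₂ / X ^ M := by
      refine le_trans ?_ hAζ
      rw [hA01, map_mul, abs_mul, mul_comm]
      gcongr
    rw [← le_div_iff₀ hpos] at hprod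
    refine hprod.trans ?_
    have hXW : X ^ W * X ^ k ≤ X ^ M := by
      rw [← Real.rpow_natCast, ← Real.rpow_natCast, ← Real.rpow_add hX0]
      exact Real.rpow_le_rpow_of_exponent_le hX hM
    calc C₂ / X ^ M / (c ^ M * ((M + 1) * X) ^ (-W)) = C₃ * (X ^ W / X ^ M) := by
          rw [Real.rpow_neg (by positivity), Real.mul_rpow (by positivity) hX0.le, hC₃]
          field_simp
      _ ≤ C₃ * (1 / X ^ k) := by
          gcongr ?_ * ?_
          rw [div_le_div_iff₀ (by positivity) (by positivity), one_mul]
          exact hXW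
      _ = C₃ / X ^ k := by ring
      _ ≤ (C₁ + C₃) / X ^ k := by gcongr; linarith
  · exact hQζ.trans (by gcongr; linarith)

/-- If `w_k(ζ) < W`, then every exponent below `k` is admissible for the uniform approximation in
degree `N`, for all `N` that are large in terms of `W` and `k`. -/
lemma eventually_exists_of_w_lt {ζ : ℝ} (hζ : Transcendental ℚ ζ) {k M N : ℕ} (hk : 1 ≤ k) {W : ℝ}
    (hW : 0 ≤ W) (h : w k ζ < W) (hM : W + k ≤ M) (hN : M + k ≤ N + 1) {s : ℝ} (hs : s < k) :
    ∀ᶠ X : ℝ in atTop, ∃ (α : ℝ) (P : ℤ[X]), IsMinimalPolynomial P α ∧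
      P.natDegree ≤ N ∧ P.supNorm ≤ X ∧ |ζ - α| ≤ P.supNorm⁻¹ * X ^ (-s) := by
  obtain ⟨c, hc0, hc1, hlow⟩ := exists_pos_mul_mahler_rpow_le hζ hW h
  obtain ⟨B, D, hB, hD, hsmall⟩ := exists_coprime_small_values hk hW hM hc0 hc1 hlow
  obtain ⟨D', hD', hnear⟩ := exists_isMinimalPolynomial_near ζ N hB
  have hk0 : (0 : ℝ) < k := by exact_mod_cast hk
  filter_upwards [(tendsto_rpow_atTop (by linarith : 0 < (k : ℝ) - s)).eventually_ge_atTop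
    (D' * D * D' ^ (k + 1)), eventually_ge_atTop D', eventually_gt_atTop (D' * (D + 1)),
    eventually_gt_atTop 0] with Y hY1 hY2 hY3 hY0
  set X := Y / D' with hX
  have hX1 : 1 ≤ X := by rwa [hX, le_div_iff₀ hD', one_mul]
  have hX0 : 0 < X := by linarith
  have hXD : D + 1 < X := by rwa [hX, lt_div_iff₀ hD', mul_comm]
  have hXk : X ≤ X ^ k := le_self_pow₀ hX1 (by omega)
  have hε1 : D / X ^ k < 1 := by
    rw [div_lt_one (by positivity)]
    linarith
  obtain ⟨A, Q, hA, hQ, hcop, hAM, hQk, hAB, hQB, hAζ, hQζ⟩ := hsmall X hX1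
  obtain ⟨α, P, hP, hPN, hPX, hα⟩ := hnear X (D / X ^ k) A Q hX1 (by positivity) (by linarith) hcop
    (natDegree_pos_of_abs_aeval_lt_one hA (hAζ.trans_lt hε1))
    (natDegree_pos_of_abs_aeval_lt_one hQ (hQζ.trans_lt hε1)) (by omega) hAB hQB hAζ hQζ
  have hPY : P.supNorm ≤ Y := hPX.trans_eq (by rw [hX]; field_simp)
  have hP1 := one_le_supNorm hP.ne_zero
  refine ⟨α, P, hP, hPN, hPY, hα.trans ?_⟩
  have h1 : Y ^ s * (D' * D * D' ^ (k + 1)) ≤ Y ^ k := by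
    calc Y ^ s * (D' * D * D' ^ (k + 1)) ≤ Y ^ s * Y ^ (k - s : ℝ) := by gcongr
      _ = Y ^ k := by rw [← Real.rpow_add hY0, ← Real.rpow_natCast]; congr 1; ring
  calc D' * (D / X ^ k) / X = Y⁻¹ * (D' * D * D' ^ (k + 1) / Y ^ k) := by
        rw [hX, div_pow, pow_succ]; field_simp
    _ ≤ P.supNorm⁻¹ * Y ^ (-s) := by
        gcongr
        rw [Real.rpow_neg hY0.le, div_le_iff₀ (by positivity), inv_mul_eq_div,
          le_div_iff₀ (by positivity), mul_comm]
        exact h1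

/-! ### The exponents as extended real numbers -/

lemma le_wHatStar {n : ℕ} {ζ b : ℝ} (h : ∀ s < b, ∀ᶠ X : ℝ in atTop,
    ∃ (α : ℝ) (P : ℤ[X]), IsMinimalPolynomial P α ∧ P.natDegree ≤ n ∧ P.supNorm ≤ X ∧
      |ζ - α| ≤ P.supNorm⁻¹ * X ^ (-s)) : (b : EReal) ≤ wHatStar n ζ :=
  EReal.ge_of_forall_gt_iff_ge.mp fun s hs =>
    le_sSup (Set.mem_image_of_mem _ (h s (EReal.coe_lt_coe_iff.mp hs)))

lemma wHatStar_mono (ζ : ℝ) : Monotone fun n => wHatStar n ζ := by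
  refine fun m n hmn => sSup_le_sSup (Set.image_mono fun t ht => ht.mono ?_)
  rintro X ⟨α, P, h1, h2, h3⟩
  exact ⟨α, P, h1, h2.trans hmn, h3⟩

/-- Rational approximations already show `1 ≤ ŵ*_n(ζ)`. -/
lemma one_le_wHatStar (ζ : ℝ) {n : ℕ} (hn : 1 ≤ n) : 1 ≤ wHatStar n ζ := by
  refine le_trans ?_ (wHatStar_mono ζ hn)
  rw [← EReal.coe_one]
  refine le_wHatStar fun s hs => ?_
  set c : ℝ := 4 * (|ζ| + 1) with hc
  have hc1 : 1 ≤ c := by linarith [abs_nonneg ζ]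
  filter_upwards [(tendsto_rpow_atTop (by linarith : 0 < 1 - s)).eventually_ge_atTop (c * c),
    eventually_ge_atTop c, eventually_gt_atTop 0] with X hX hXc hX0
  have hpos : 0 < ⌊X / c⌋₊ := Nat.floor_pos.mpr (by rwa [le_div_iff₀ (by linarith), one_mul])
  obtain ⟨q, hq, hqd⟩ := Real.exists_rat_abs_sub_le_and_den_le ζ hpos
  have hd0 : (0 : ℝ) < q.den := by exact_mod_cast q.den_pos
  have hd1 : (1 : ℝ) ≤ q.den := by exact_mod_cast q.den_pos
  let F : ℤ[X] := C (q.den : ℤ) * Polynomial.X + C (-q.num)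
  have hFd : F.natDegree ≤ 1 := natDegree_linear_le
  have hF1 : F.coeff 1 = q.den := by
    simp only [F, coeff_add, coeff_C_mul, coeff_X_one, coeff_C_succ, mul_one, add_zero]
  have hF : F ≠ 0 := fun h0 => by
    rw [h0, coeff_zero] at hF1
    exact q.den_ne_zero (by exact_mod_cast hF1.symm)
  have hqv : (q : ℝ) * q.den = q.num := by exact_mod_cast q.mul_den_eq_num
  have hFq : aeval (q : ℝ) F = 0 := by
    simp only [F, map_add, map_mul, aeval_C, aeval_X]
    simp
    linarith
  have hnum : |(q.num : ℝ)| ≤ (|ζ| + 1) * q.den := by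
    rw [← hqv, abs_mul, Nat.abs_cast]
    gcongr
    have h1 : |ζ - q| ≤ 1 := hq.trans (by
      rw [div_le_one (by positivity)]
      exact one_le_mul_of_one_le_of_one_le
        (by linarith [(Nat.cast_nonneg ⌊X / c⌋₊ : (0 : ℝ) ≤ _)]) hd1)
    rw [abs_sub_comm] at h1
    linarith [abs_sub_abs_le_abs_sub (q : ℝ) ζ]
  have hFH : F.supNorm ≤ (|ζ| + 1) * q.den := supNorm_le_of_forall fun i => by
    rcases i with _ | _ | i
    · simpa [F] using hnum
    · rw [hF1, Int.cast_natCast, Nat.abs_cast]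
      exact le_mul_of_one_le_left hd0.le (by linarith [abs_nonneg ζ])
    · rw [coeff_eq_zero_of_natDegree_lt (by omega)]
      simp only [Int.cast_zero, abs_zero]
      positivity
  obtain ⟨P, hP, hPF⟩ := exists_isMinimalPolynomial_dvd hF hFq
  have hP1 := one_le_supNorm hP.ne_zero
  have hPH : P.supNorm ≤ c * q.den := by
    refine (supNorm_le_of_dvd hPF hF hFd).trans ?_
    calc (2 : ℝ) ^ 1 * ((1 : ℕ) + 1) * F.supNorm ≤ 2 ^ 1 * ((1 : ℕ) + 1) * ((|ζ| + 1) * q.den) := by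
          gcongr
      _ = c * q.den := by rw [hc]; push_cast; ring
  refine ⟨q, P, hP, (natDegree_le_of_dvd hPF hF).trans hFd, hPH.trans ?_, hq.trans ?_⟩
  · calc c * (q.den : ℝ) ≤ c * (⌊X / c⌋₊ : ℝ) := by gcongr
      _ ≤ c * (X / c) := by gcongr; exact Nat.floor_le (by positivity)
      _ = X := by field_simp
  · have h1 : X / c ≤ ⌊X / c⌋₊ + 1 := (Nat.lt_floor_add_one _).le
    have h2 : c * c * X ^ s ≤ X := by
      calc c * c * X ^ s ≤ X ^ (1 - s) * X ^ s := by gcongr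
        _ = X := by rw [← Real.rpow_add hX0, sub_add_cancel, Real.rpow_one]
    calc 1 / ((⌊X / c⌋₊ + 1) * (q.den : ℝ)) ≤ 1 / (X / c * (P.supNorm / c)) := by
          gcongr
          rwa [div_le_iff₀ (by linarith), mul_comm]
      _ = P.supNorm⁻¹ * (c * c / X) := by field_simp
      _ ≤ P.supNorm⁻¹ * X ^ (-s) := by
          gcongr
          rw [Real.rpow_neg hX0.le, div_le_iff₀ hX0, inv_mul_eq_div, le_div_iff₀ (by positivity)]
          exact h2

lemma natCast_le_wHatStar {ζ : ℝ} (hζ : Transcendental ℚ ζ) {k M N : ℕ} (hk : 1 ≤ k) {W : ℝ}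
    (hW : 0 ≤ W) (h : w k ζ < W) (hM : W + k ≤ M) (hN : M + k ≤ N + 1) :
    ((k : ℝ) : EReal) ≤ wHatStar N ζ :=
  le_wHatStar fun _ hs => eventually_exists_of_w_lt hζ hk hW h hM hN hs

lemma wHatStar_le_of_lt_w {ζ : ℝ} (hζ : Transcendental ℚ ζ) {k n : ℕ} (hk : 1 ≤ k) {t : ℝ}
    (ht : (n : ℝ) ≤ t) (h : (t : EReal) < w k ζ) :
    wHatStar n ζ ≤ ((k + k * n / (t - n + 1) : ℝ) : EReal) := by
  obtain ⟨_, ⟨t', ht', rfl⟩, htt'⟩ := lt_sSup_iff.mp h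
  have htt : t < t' := EReal.coe_lt_coe_iff.mp htt'
  refine sSup_le ?_
  rintro _ ⟨s, hs, rfl⟩
  refine EReal.coe_le_coe_iff.mpr ((le_of_infinite hζ hk (ht.trans htt.le) ht' hs).trans ?_)
  have : 0 < t - n + 1 := by linarith
  gcongr

lemma exists_nonneg_w_lt {k : ℕ} {ζ : ℝ} (h : w k ζ < ⊤) : ∃ W : ℝ, 0 ≤ W ∧ w k ζ < W := by
  obtain ⟨W, hW, -⟩ := EReal.lt_iff_exists_real_btwn.mp h
  exact ⟨max W 0, le_max_right _ _, hW.trans_le (EReal.coe_le_coe_iff.mpr (le_max_left _ _))⟩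

lemma eventually_natCast_le_wHatStar {ζ : ℝ} (hζ : Transcendental ℚ ζ) {k : ℕ} (hk : 1 ≤ k)
    (h : w k ζ < ⊤) : ∀ᶠ n in atTop, ((k : ℝ) : EReal) ≤ wHatStar n ζ := by
  obtain ⟨W, hW, hwW⟩ := exists_nonneg_w_lt h
  obtain ⟨M, hM⟩ := exists_nat_ge (W + k)
  filter_upwards [eventually_ge_atTop (M + k)] with n hn
  exact natCast_le_wHatStar hζ hk hW hwW hM (by omega)

lemma tendsto_wHatStar_top {ζ : ℝ} (hζ : Transcendental ℚ ζ) (h : ∀ k, 1 ≤ k → w k ζ < ⊤) :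
    Tendsto (fun n => wHatStar n ζ) atTop (𝓝 ⊤) := by
  refine EReal.tendsto_nhds_top_iff_real.mpr fun x => ?_
  obtain ⟨k, hk⟩ := exists_nat_gt x
  filter_upwards [eventually_natCast_le_wHatStar hζ (Nat.le_add_left 1 k) (h _ (by omega))]
    with n hn
  refine lt_of_lt_of_le (EReal.coe_lt_coe_iff.mpr ?_) hn
  push_cast
  linarith

/-! ### `U`-numbers -/

lemma IsUmNumber.wHatStar_le {m : ℕ} {ζ : ℝ} (h : IsUmNumber m ζ) (n : ℕ) :
    wHatStar n ζ ≤ ((m : ℝ) : EReal) := by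
  refine EReal.le_of_forall_lt_iff_le.mp fun z hz => ?_
  have hz' : 0 < z - m := sub_pos.mpr (EReal.coe_lt_coe_iff.mp hz)
  set t : ℝ := n + m * n / (z - m) with ht
  have hd : 0 ≤ (m : ℝ) * n / (z - m) := by positivity
  refine (wHatStar_le_of_lt_w h.1 h.2.1 (t := t) (by linarith)
    (h.2.2.1 ▸ EReal.coe_lt_top t)).trans (EReal.coe_le_coe_iff.mpr ?_)
  have h1 : (m : ℝ) * n / (t - n + 1) ≤ z - m := by
    rw [div_le_iff₀ (by linarith)]
    have h2 : (z - m) * (t - n + 1) = m * n + (z - m) := by rw [ht]; field_simp; ring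
    linarith
  linarith

lemma IsUmNumber.eventually_mem_Icc {m : ℕ} {ζ : ℝ} (h : IsUmNumber m ζ) :
    ∀ᶠ n : ℕ in atTop, wHatStar n ζ ∈ Set.Icc (((m : ℝ) - 1 : ℝ) : EReal) ((m : ℝ) : EReal) := by
  have hlow : ∀ᶠ n in atTop, (((m : ℝ) - 1 : ℝ) : EReal) ≤ wHatStar n ζ := by
    obtain ⟨k, rfl⟩ : ∃ k, m = k + 1 := ⟨m - 1, by have := h.2.1; omega⟩
    rcases Nat.eq_zero_or_pos k with rfl | hk
    · filter_upwards [eventually_ge_atTop 1] with n hn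
      refine le_trans ?_ (one_le_wHatStar ζ hn)
      simp
    · simpa using eventually_natCast_le_wHatStar h.1 hk (h.2.2.2 k hk (Nat.lt_succ_self k))
  exact hlow.mono fun n hn => ⟨hn, h.wHatStar_le n⟩

lemma IsUmNumber.not_tendsto_top {m : ℕ} {ζ : ℝ} (h : IsUmNumber m ζ) :
    ¬ Tendsto (fun n => wHatStar n ζ) atTop (𝓝 ⊤) := fun ht =>
  (EReal.coe_lt_top (m : ℝ)).not_ge (le_of_tendsto' ht h.wHatStar_le)

lemma IsUmNumber.exists_tendsto {m : ℕ} {ζ : ℝ} (h : IsUmNumber m ζ) :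
    ∃ L : ℝ, Tendsto (fun n => wHatStar n ζ) atTop (𝓝 (L : EReal)) := by
  have ht := tendsto_atTop_iSup (wHatStar_mono ζ)
  have h1 : (⨆ n, wHatStar n ζ) ≤ ((m : ℝ) : EReal) := iSup_le h.wHatStar_le
  have h2 : (1 : EReal) ≤ ⨆ n, wHatStar n ζ :=
    (one_le_wHatStar ζ le_rfl).trans (le_iSup (fun n => wHatStar n ζ) 1)
  refine ⟨(⨆ n, wHatStar n ζ).toReal, ?_⟩
  rwa [EReal.coe_toReal (ne_top_of_le_ne_top (EReal.coe_ne_top _) h1)]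
  intro h0
  rw [h0] at h2
  exact absurd h2 (not_le_of_gt (by rw [← EReal.coe_one]; exact EReal.bot_lt_coe 1))

lemma w_lt_top_of_not_isUNumber {ζ : ℝ} (hζ : Transcendental ℚ ζ) (h : ¬ IsUNumber ζ) :
    ∀ k, 1 ≤ k → w k ζ < ⊤ := by
  classical
  by_contra! hex
  have hex' : ∃ k, 1 ≤ k ∧ w k ζ = ⊤ := hex.imp fun k hk => ⟨hk.1, top_le_iff.mp hk.2⟩
  refine h ⟨Nat.find hex', hζ, (Nat.find_spec hex').1, (Nat.find_spec hex').2, fun k hk1 hk => ?_⟩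
  exact lt_top_iff_ne_top.mpr fun h0 => Nat.find_min hex' hk ⟨hk1, h0⟩

lemma isUNumber_iff_exists_tendsto {ζ : ℝ} (hζ : Transcendental ℚ ζ) :
    IsUNumber ζ ↔ ∃ L : ℝ, Tendsto (fun n : ℕ => wHatStar n ζ) atTop (𝓝 (L : EReal)) := by
  refine ⟨fun ⟨m, hm⟩ => hm.exists_tendsto, fun ⟨L, hL⟩ => by_contra fun h => ?_⟩
  exact EReal.coe_ne_top L
    (tendsto_nhds_unique hL (tendsto_wHatStar_top hζ (w_lt_top_of_not_isUNumber hζ h)))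

/-! ### `S`-numbers and `T`-numbers -/

lemma wHatStar_mul_le {ζ : ℝ} (hζ : Transcendental ℚ ζ) {k : ℕ} (hk : 1 ≤ k) (b : ℕ)
    (h : ((2 * b * k : ℝ) : EReal) < w k ζ) : wHatStar (b * k) ζ ≤ ((2 * k : ℝ) : EReal) := by
  have h0 : (0 : ℝ) ≤ b * k := by positivity
  refine (wHatStar_le_of_lt_w hζ hk (t := 2 * b * k) (by push_cast; linarith) h).trans
    (EReal.coe_le_coe_iff.mpr ?_)
  push_cast
  have h1 : (k : ℝ) * (b * k) / (2 * b * k - b * k + 1) ≤ k := by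
    rw [div_le_iff₀ (by linarith)]
    nlinarith [(Nat.cast_nonneg k : (0 : ℝ) ≤ k)]
  linarith

lemma exists_mul_le_wHatStar {ζ : ℝ} (hζ : Transcendental ℚ ζ) {C : ℝ}
    (hC : ∀ n : ℕ, 1 ≤ n → w n ζ ≤ ((C * n : ℝ) : EReal)) :
    ∃ δ : ℝ, 0 < δ ∧ ∀ n : ℕ, 1 ≤ n → ((δ * n : ℝ) : EReal) ≤ wHatStar n ζ := by
  obtain ⟨c, hc⟩ := exists_nat_ge C
  have hlow : ∀ k : ℕ, 1 ≤ k → ((k : ℝ) : EReal) ≤ wHatStar ((c + 3) * k) ζ := fun k hk => by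
    refine natCast_le_wHatStar hζ hk (W := c * k + 1) (M := c * k + 1 + k) (by positivity)
      ((hC k hk).trans_lt (EReal.coe_lt_coe_iff.mpr ?_)) (by push_cast; linarith) ?_
    · have : C * k ≤ c * k := by gcongr
      linarith
    · linarith
  have hc0 : (0 : ℝ) < c + 3 := by positivity
  refine ⟨1 / (2 * (c + 3)), by positivity, fun n hn => ?_⟩
  have hdiv := Nat.div_add_mod n (c + 3)
  have hmod := Nat.mod_lt n (show 0 < c + 3 by omega)
  set k := n / (c + 3) with hk
  rcases Nat.eq_zero_or_pos k with h0 | h0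
  · refine le_trans ?_ (one_le_wHatStar ζ hn)
    rw [← EReal.coe_one, EReal.coe_le_coe_iff, one_div, inv_mul_eq_div, div_le_one (by positivity)]
    have : (n : ℝ) ≤ c + 3 := by
      rw [h0, mul_zero, zero_add] at hdiv
      exact_mod_cast (hdiv ▸ hmod).le
    linarith
  · refine le_trans (EReal.coe_le_coe_iff.mpr ?_) ((hlow k h0).trans (wHatStar_mono ζ (by omega)))
    rw [one_div, inv_mul_eq_div, div_le_iff₀ (by positivity)]
    have h1 : n ≤ k * (2 * (c + 3)) := by nlinarith
    exact_mod_cast h1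

lemma exists_w_le_mul {ζ : ℝ} (hζ : Transcendental ℚ ζ) {δ : ℝ} (hδ : 0 < δ)
    (h : ∀ n : ℕ, 1 ≤ n → ((δ * n : ℝ) : EReal) ≤ wHatStar n ζ) :
    ∃ C : ℝ, ∀ n : ℕ, 1 ≤ n → w n ζ ≤ ((C * n : ℝ) : EReal) := by
  obtain ⟨b, hb⟩ := exists_nat_gt (2 / δ)
  refine ⟨2 * b, fun k hk => not_lt.mp fun hlt => ?_⟩
  have hb0 : 0 < b := by
    have : (0 : ℝ) < b := lt_trans (by positivity) hb
    exact_mod_cast this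
  have h1 := EReal.coe_le_coe_iff.mp
    ((h (b * k) (Nat.mul_pos hb0 hk)).trans (wHatStar_mul_le hζ hk b hlt))
  rw [div_lt_iff₀ hδ] at hb
  have hk0 : (0 : ℝ) < k := by exact_mod_cast hk
  push_cast at h1
  nlinarith

lemma isSNumber_iff_exists_mul_le {ζ : ℝ} (hζ : Transcendental ℚ ζ) :
    IsSNumber ζ ↔ ∃ δ : ℝ, 0 < δ ∧ ∀ n : ℕ, 1 ≤ n → ((δ * n : ℝ) : EReal) ≤ wHatStar n ζ :=
  ⟨fun ⟨_, _, hC⟩ => exists_mul_le_wHatStar hζ hC, fun ⟨_, hδ, h⟩ => ⟨hζ, exists_w_le_mul hζ hδ h⟩⟩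

lemma coe_natCast_pos {n : ℕ} (hn : 1 ≤ n) : (0 : EReal) < ((n : ℝ) : EReal) :=
  EReal.coe_pos.mpr (by exact_mod_cast hn)

lemma liminf_wHatStar_div_eq_zero {ζ : ℝ} (hζ : Transcendental ℚ ζ)
    (h : limsup (fun n : ℕ => w n ζ / ((n : ℝ) : EReal)) atTop = ⊤) :
    liminf (fun n : ℕ => wHatStar n ζ / ((n : ℝ) : EReal)) atTop = 0 := by
  refine le_antisymm ?_ ?_
  · rw [← EReal.coe_zero]
    refine EReal.le_of_forall_lt_iff_le.mp fun z hz => ?_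
    have hz0 : 0 < z := EReal.coe_lt_coe_iff.mp hz
    obtain ⟨b, hb⟩ := exists_nat_gt (2 / z)
    have hb0 : (0 : ℝ) < b := lt_trans (by positivity) hb
    have hb1 : 1 ≤ b := by exact_mod_cast hb0
    have hfreq : ∃ᶠ k : ℕ in atTop, ((2 * b : ℝ) : EReal) < w k ζ / ((k : ℝ) : EReal) :=
      frequently_lt_of_lt_limsup (by isBoundedDefault) (h ▸ EReal.coe_lt_top _)
    have htend : Tendsto (fun k : ℕ => b * k) atTop atTop :=
      tendsto_id.const_mul_atTop' hb1
    refine liminf_le_of_frequently_le (htend.frequently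
      ((hfreq.and_eventually (eventually_ge_atTop 1)).mono fun k hk => ?_)) (by isBoundedDefault)
    obtain ⟨hk, hk1⟩ := hk
    have hk0 : (0 : ℝ) < k := by exact_mod_cast hk1
    rw [EReal.lt_div_iff (coe_natCast_pos hk1) (EReal.coe_ne_top _), ← EReal.coe_mul] at hk
    rw [EReal.div_le_iff_le_mul (coe_natCast_pos (Nat.mul_pos hb1 hk1)) (EReal.coe_ne_top _),
      ← EReal.coe_mul]
    refine (wHatStar_mul_le hζ hk1 b hk).trans (EReal.coe_le_coe_iff.mpr ?_)
    rw [div_lt_iff₀ hz0] at hb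
    push_cast
    nlinarith
  · refine le_liminf_of_le (by isBoundedDefault) ?_
    filter_upwards [eventually_ge_atTop 1] with n hn
    exact EReal.div_nonneg (zero_le_one.trans (one_le_wHatStar ζ hn)) (coe_natCast_pos hn).le

lemma exists_w_le_mul_of_limsup_ne_top {ζ : ℝ} (hw : ∀ k, 1 ≤ k → w k ζ < ⊤)
    (h : limsup (fun n : ℕ => w n ζ / ((n : ℝ) : EReal)) atTop ≠ ⊤) :
    ∃ C : ℝ, ∀ n : ℕ, 1 ≤ n → w n ζ ≤ ((C * n : ℝ) : EReal) := by
  obtain ⟨C, hC, -⟩ := EReal.lt_iff_exists_real_btwn.mp (lt_top_iff_ne_top.mpr h)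
  obtain ⟨n₀, hn₀⟩ := eventually_atTop.mp
    (eventually_lt_of_limsup_lt hC (by isBoundedDefault))
  choose W hW0 hW using fun k : ℕ => exists_nonneg_w_lt (hw (k + 1) (by omega))
  have hsum : 0 ≤ ∑ i ∈ Finset.range n₀, W i := Finset.sum_nonneg fun i _ => hW0 i
  refine ⟨max C (∑ i ∈ Finset.range n₀, W i), fun n hn => ?_⟩
  have hn1 : (1 : ℝ) ≤ n := by exact_mod_cast hn
  rcases lt_or_ge n n₀ with hlt | hge
  · obtain ⟨k, rfl⟩ : ∃ k, n = k + 1 := ⟨n - 1, by omega⟩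
    refine (hW k).le.trans (EReal.coe_le_coe_iff.mpr ?_)
    have h1 : W k ≤ ∑ i ∈ Finset.range n₀, W i :=
      Finset.single_le_sum (fun i _ => hW0 i) (Finset.mem_range.mpr (by omega))
    exact (h1.trans (le_max_right _ _)).trans
      (le_mul_of_one_le_right (le_max_of_le_right hsum) hn1)
  · have h1 := hn₀ n hge
    rw [EReal.div_lt_iff (coe_natCast_pos hn) (EReal.coe_ne_top _), ← EReal.coe_mul] at h1
    refine h1.le.trans (EReal.coe_le_coe_iff.mpr ?_)
    gcongr
    exact le_max_left _ _

lemma isTNumber_iff_tendsto_and_liminf {ζ : ℝ} (hζ : Transcendental ℚ ζ) :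
    IsTNumber ζ ↔ Tendsto (fun n : ℕ => wHatStar n ζ) atTop (𝓝 ⊤) ∧
      liminf (fun n : ℕ => wHatStar n ζ / ((n : ℝ) : EReal)) atTop = 0 := by
  constructor
  · rintro ⟨-, hw, hlim⟩
    exact ⟨tendsto_wHatStar_top hζ hw, liminf_wHatStar_div_eq_zero hζ hlim⟩
  · rintro ⟨htop, hlim⟩
    have hw := w_lt_top_of_not_isUNumber hζ fun ⟨_, hm⟩ => hm.not_tendsto_top htop
    refine ⟨hζ, hw, by_contra fun hne => ?_⟩
    obtain ⟨C, hC⟩ := exists_w_le_mul_of_limsup_ne_top hw hne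
    obtain ⟨δ, hδ, hδn⟩ := exists_mul_le_wHatStar hζ hC
    have h1 : ((δ : ℝ) : EReal) ≤
        liminf (fun n : ℕ => wHatStar n ζ / ((n : ℝ) : EReal)) atTop := by
      refine le_liminf_of_le (by isBoundedDefault) ?_
      filter_upwards [eventually_ge_atTop 1] with n hn
      rw [EReal.le_div_iff_mul_le (coe_natCast_pos hn) (EReal.coe_ne_top _), ← EReal.coe_mul]
      exact hδn n hn
    rw [hlim] at h1
    exact absurd (EReal.coe_nonpos.mp h1) (not_le_of_gt hδ)

end MahlerClassification

theorem theorem2p4 (ζ : ℝ) (hζ : Transcendental ℚ ζ) :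
    (MahlerClassification.IsUNumber ζ ↔
      ∃ L : ℝ, Tendsto (fun n : ℕ => MahlerClassification.wHatStar n ζ) atTop (𝓝 (L : EReal))) ∧
    (∀ m : ℕ, MahlerClassification.IsUmNumber m ζ →
      ∀ᶠ n : ℕ in atTop, MahlerClassification.wHatStar n ζ ∈
        Set.Icc (((m : ℝ) - 1 : ℝ) : EReal) ((m : ℝ) : EReal)) ∧
    (MahlerClassification.IsTNumber ζ ↔
      Tendsto (fun n : ℕ => MahlerClassification.wHatStar n ζ) atTop (𝓝 ⊤) ∧
      liminf (fun n : ℕ => MahlerClassification.wHatStar n ζ / ((n : ℝ) : EReal)) atTop = 0) ∧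
    (MahlerClassification.IsSNumber ζ ↔
      ∃ δ : ℝ, 0 < δ ∧ ∀ n : ℕ, 1 ≤ n →
        ((δ * n : ℝ) : EReal) ≤ MahlerClassification.wHatStar n ζ) :=
  ⟨MahlerClassification.isUNumber_iff_exists_tendsto hζ,
    fun _ hm => hm.eventually_mem_Icc,
    MahlerClassification.isTNumber_iff_tendsto_and_liminf hζ,
    MahlerClassification.isSNumber_iff_exists_mul_le hζ⟩
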